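/- **Theorem (Score $P$-separation with KSDs).** Let $K:\mathbb{R}^d\times\mathbb{R}^d\to\mathbb{R}^{d\times d}$ be a (positive semidefinite) matrix-valued reproducing kernel whose reproducing kernel Hilbert space $\mathcal{H}_K$ of $\mathbb{R}^d$-valued functions is contained in $C^1_b(\mathbb{R}^d)$, the space of continuously differentiable vector fields that are bounded together with their first derivatives. Equip $C^1_b(\mathbb{R}^d)$ with the strict topology, given by the seminorms $f\mapsto\sup_x\|\gamma(x)f(x)\|$ and $f\mapsto\sup_x\|\gamma(x)\partial f(x)\|$ with $\gamma$ continuous and vanishing at infinity, and let $\mathcal{D}^1_{L^1}(\mathbb{R}^d)$ be its continuous dual. Suppose that $K$ is characteristic to $\mathcal{D}^1_{L^1}(\mathbb{R}^d)$: the kernel embedding $D\mapsto\Phi_K(D)\in\mathcal{H}_K$, defined by $D(h)=\langle\Phi_K(D),h\rangle_K$ for all $h\in\mathcal{H}_K$, is injective on $\mathcal{D}^1_{L^1}(\mathbb{R}^d)$. Let $P$ be a probability measure on $\mathbb{R}^d$ with an everywhere strictly positive Lebesgue density $p$, and put $\mathcal{S}_p(v)=\frac1p\sum_j\partial_{x^j}(p\,v^j)$.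 Suppose that $P$ has a zero-mean Stein RKHS: $p\,h$ is partially differentiable, $\mathcal{S}_p(h)\in L^1(P)$ and $\int\mathcal{S}_p(h)\,dP=0$ for every $h\in\mathcal{H}_K$. Then $\log p$ is partially differentiable, so that the score $s_p=\partial\log p$ is defined everywhere; the Stein kernel $$k_p(x,y)=\frac{1}{p(x)p(y)}\sum_{i,j=1}^d\partial_{y^j}\partial_{x^i}\bigl(p(x)K(x,y)_{ij}\,p(y)\bigr)$$ is a reproducing kernel with $\mathcal{H}_{k_p}\subset L^1(P)$; and $k_p$ separates $P$ from the set of all Borel probability measures $Q$ on $\mathbb{R}^d$ with $\int\|s_p\|\,dQ<\infty$. That is, for every such $Q$ (no density or smoothness is required of $Q$), if $$\mathrm{MMD}_{k_p}(Q,P)=\sup\Bigl\{\bigl|\textstyle\int h\,dQ-\int h\,dP\bigr| : h\in\mathcal{H}_{k_p},\ \|h\|_{k_p}\le1,\ h_+\in L^1(Q)\Bigr\}=0,$$ then $Q=P$. -/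

import Mathlib

open MeasureTheory
open scoped ENNReal ZeroAtInfty

noncomputable section

namespace KSD

/-- The Euclidean space `ℝᵈ`. -/
abbrev E (d : ℕ) := EuclideanSpace ℝ (Fin d)

/-- The canonical basis vector `e_i` of `ℝᵈ`. -/
abbrev e {d : ℕ} (i : Fin d) : E d := EuclideanSpace.single i 1

/-! ### Scalar kernels, embeddability, MMD and separation -/

section MMD

variable {X : Type*}

/-- A scalar-valued function of two arguments, as an `X × X` matrix of operators on `ℝ`. -/
def scalarKernel (k : X → X → ℝ) : Matrix X X (ℝ →L[ℝ] ℝ) :=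
  Matrix.of fun x y => k x y • ContinuousLinearMap.id ℝ ℝ

variable [MeasurableSpace X]

/-- The embeddable probability measures of a scalar kernel `k`: those `Q` for which every function
of the reproducing kernel Hilbert space `H_k` belongs to `L¹(Q)`. -/
def embeddable (k : Matrix X X (ℝ →L[ℝ] ℝ)) [Fact k.PosSemidef] : Set (Measure X) :=
  {Q | IsProbabilityMeasure Q ∧ ∀ h : RKHS.OfKernel k, Integrable (fun x => h x) Q}

/-- The integral `Q h = Q h₊ - Q h₋` with values in `[-∞, ∞]`; it is only used for functions with
`h₊ ∈ L¹(Q)`, so that `∞ - ∞` does not occur. -/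
def extIntegral (Q : Measure X) (h : X → ℝ) : EReal :=
  ((∫⁻ x, ENNReal.ofReal (h x) ∂Q : ℝ≥0∞) : EReal)
    - ((∫⁻ x, ENNReal.ofReal (-h x) ∂Q : ℝ≥0∞) : EReal)

/-- The maximum mean discrepancy `MMD_k(Q, P) ∈ [0, ∞]`, for `P` embeddable: the supremum of
`|Q h - P h|` over the `h` in the unit ball of `H_k` with `h₊ ∈ L¹(Q)`. -/
def mmd (k : Matrix X X (ℝ →L[ℝ] ℝ)) [Fact k.PosSemidef] (Q P : Measure X) : ℝ≥0∞ :=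
  ⨆ (h : RKHS.OfKernel k) (_ : ‖h‖ ≤ 1) (_ : Integrable (fun x => max (h x) 0) Q),
    (extIntegral Q (fun x => h x) - ((∫ x, h x ∂P : ℝ) : EReal)).abs

/-- The kernel `k` separates `P` from the set `M` of probability measures. -/
def Separates (k : Matrix X X (ℝ →L[ℝ] ℝ)) [Fact k.PosSemidef] (P : Measure X)
    (M : Set (Measure X)) : Prop :=
  ∀ Q ∈ M, mmd k Q P = 0 → Q = P

end MMD

/-! ### The space `C¹_b(ℝᵈ)` with its strict topology, and its dual -/

/-- Continuously differentiable vector fields, bounded with bounded derivative. -/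
def c1bSubmodule (d : ℕ) : Submodule ℝ (E d → E d) where
  carrier := {f | ContDiff ℝ 1 f ∧ (∃ C, ∀ x, ‖f x‖ ≤ C) ∧ ∃ C, ∀ x, ‖fderiv ℝ f x‖ ≤ C}
  zero_mem' := ⟨contDiff_const, ⟨0, by simp⟩, ⟨0, by simp⟩⟩
  add_mem' := by
    rintro f g ⟨hf, ⟨A, hA⟩, ⟨B, hB⟩⟩ ⟨hg, ⟨A', hA'⟩, ⟨B', hB'⟩⟩
    refine ⟨hf.add hg, ⟨A + A', fun x => (norm_add_le _ _).trans (add_le_add (hA x) (hA' x))⟩,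
      ⟨B + B', fun x => ?_⟩⟩
    rw [fderiv_add (hf.differentiable one_ne_zero x) (hg.differentiable one_ne_zero x)]
    exact (norm_add_le _ _).trans (add_le_add (hB x) (hB' x))
  smul_mem' := by
    rintro c f ⟨hf, ⟨A, hA⟩, ⟨B, hB⟩⟩
    refine ⟨contDiff_const.smul hf, ⟨‖c‖ * A, fun x => ?_⟩, ⟨‖c‖ * B, fun x => ?_⟩⟩
    · simp only [Pi.smul_apply, norm_smul]
      exact mul_le_mul_of_nonneg_left (hA x) (norm_nonneg _)
    · rw [fderiv_const_smul (hf.differentiable one_ne_zero x), norm_smul]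
      exact mul_le_mul_of_nonneg_left (hB x) (norm_nonneg _)

/-- The vector space `C¹_b(ℝᵈ)` of `ℝᵈ`-valued functions; it is a type of its own so that it
carries the strict topology below and not the topology of pointwise convergence. -/
def C1b (d : ℕ) : Type := ↥(c1bSubmodule d)

instance (d : ℕ) : AddCommGroup (C1b d) := inferInstanceAs (AddCommGroup ↥(c1bSubmodule d))

instance (d : ℕ) : Module ℝ (C1b d) := inferInstanceAs (Module ℝ ↥(c1bSubmodule d))

/-- The function underlying an element of `C¹_b(ℝᵈ)`. -/
def C1b.toFun {d : ℕ} (f : C1b d) : E d → E d := f.1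

theorem C1b.toFun_add {d : ℕ} (f g : C1b d) : (f + g).toFun = f.toFun + g.toFun := rfl

theorem C1b.toFun_smul {d : ℕ} (c : ℝ) (f : C1b d) : (c • f).toFun = c • f.toFun := rfl

theorem C1b.differentiable {d : ℕ} (f : C1b d) : Differentiable ℝ f.toFun :=
  f.2.1.differentiable one_ne_zero

theorem bddAbove_weight {d : ℕ} {F : Type*} [NormedAddCommGroup F] (γ : C₀(E d, ℝ))
    {f : E d → F} (hf : ∃ C, ∀ x, ‖f x‖ ≤ C) : BddAbove (Set.range fun x => |γ x| * ‖f x‖) := by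
  obtain ⟨C, hC⟩ := hf
  refine ⟨‖γ.toBCF‖ * C, ?_⟩
  rintro _ ⟨x, rfl⟩
  exact mul_le_mul (γ.toBCF.norm_coe_le_norm x) (hC x) (norm_nonneg _) (norm_nonneg _)

/-- The seminorm `f ↦ sup_x ‖γ(x) (L f)(x)‖` attached to a linear map `L` into bounded functions
and a weight `γ` vanishing at infinity. -/
def weightedSeminorm {d : ℕ} {F : Type*} [NormedAddCommGroup F] [NormedSpace ℝ F]
    (L : C1b d → E d → F) (hadd : ∀ f g, L (f + g) = L f + L g)
    (hsmul : ∀ (c : ℝ) f, L (c • f) = c • L f) (hbdd : ∀ f, ∃ C, ∀ x, ‖L f x‖ ≤ C)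
    (γ : C₀(E d, ℝ)) : Seminorm ℝ (C1b d) :=
  Seminorm.of (fun f => ⨆ x, |γ x| * ‖L f x‖)
    (fun f g => by
      refine ciSup_le fun x => ?_
      rw [hadd]
      refine (mul_le_mul_of_nonneg_left (norm_add_le _ _) (abs_nonneg _)).trans ?_
      rw [mul_add]
      exact add_le_add (le_ciSup (bddAbove_weight γ (hbdd f)) x)
        (le_ciSup (bddAbove_weight γ (hbdd g)) x))
    (fun c f => by
      rw [hsmul, Real.mul_iSup_of_nonneg (norm_nonneg _)]
      congr 1
      funext x
      rw [Pi.smul_apply, norm_smul]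
      ring)

/-- The seminorms `f ↦ sup_x ‖γ(x) f(x)‖` and `f ↦ sup_x ‖γ(x) ∂f(x)‖`, where `γ` runs over the
continuous real functions vanishing at infinity. -/
def strictSeminorms (d : ℕ) : SeminormFamily ℝ (C1b d) (C₀(E d, ℝ) ⊕ C₀(E d, ℝ))
  | .inl γ => weightedSeminorm (fun f => f.toFun) (fun _ _ => rfl) (fun _ _ => rfl)
      (fun f => f.2.2.1) γ
  | .inr γ => weightedSeminorm (fun f => fderiv ℝ f.toFun)
      (fun f g => by
        funext x
        rw [C1b.toFun_add, fderiv_add (f.differentiable x) (g.differentiable x)]; rfl)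
      (fun c f => by
        funext x
        rw [C1b.toFun_smul, fderiv_const_smul (f.differentiable x)]; rfl)
      (fun f => f.2.2.2) γ

/-- The strict topology on `C¹_b(ℝᵈ)`. -/
instance (d : ℕ) : TopologicalSpace (C1b d) := (strictSeminorms d).moduleFilterBasis.topology

theorem withSeminorms_strictSeminorms (d : ℕ) : WithSeminorms (strictSeminorms d) := ⟨rfl⟩

/-- The space `D¹_{L¹}(ℝᵈ)` of Schwartz distributions: the continuous linear functionals on
`C¹_b(ℝᵈ)` with the strict topology. -/
abbrev DL1 (d : ℕ) := C1b d →L[ℝ] ℝ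

/-! ### Matrix-valued kernels and characteristicness -/

/-- A matrix-valued kernel `K : ℝᵈ × ℝᵈ → ℝ^{d × d}`. -/
abbrev MatrixKernel (d : ℕ) := Matrix (E d) (E d) (E d →L[ℝ] E d)

section Base

variable {d : ℕ} (K : MatrixKernel d) [Fact K.PosSemidef]

/-- `Φ ∈ H_K` is the kernel embedding of `D`, that is `D h = ⟨Φ, h⟩_K` for all `h ∈ H_K`. -/
def IsKernelEmbedding (hK : ∀ h : RKHS.OfKernel K, (fun x => h x) ∈ c1bSubmodule d)
    (D : DL1 d) (Φ : RKHS.OfKernel K) : Prop :=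
  ∀ h : RKHS.OfKernel K, D (⟨fun x => h x, hK h⟩ : c1bSubmodule d) = inner ℝ Φ h

/-- `K` (with `H_K ⊂ C¹_b(ℝᵈ)`) is characteristic to `D¹_{L¹}(ℝᵈ)`: the kernel embedding
`D ↦ Φ_K(D)` is injective. -/
def IsDL1Characteristic (hK : ∀ h : RKHS.OfKernel K, (fun x => h x) ∈ c1bSubmodule d) : Prop :=
  ∀ (D₁ D₂ : DL1 d) (Φ : RKHS.OfKernel K),
    IsKernelEmbedding K hK D₁ Φ → IsKernelEmbedding K hK D₂ Φ → D₁ = D₂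

end Base

/-! ### Langevin Stein operator, Stein kernel, score -/

section Stein

variable {d : ℕ}

/-- The `i`-th partial derivative `∂_{x^i} f`. -/
def partialDeriv (i : Fin d) (f : E d → ℝ) (x : E d) : ℝ := lineDeriv ℝ f x (e i)

/-- `f` has all first-order partial derivatives at every point. -/
def PartiallyDifferentiable {F : Type*} [NormedAddCommGroup F] [NormedSpace ℝ F]
    (f : E d → F) : Prop :=
  ∀ (x : E d) (i : Fin d), LineDifferentiableAt ℝ f x (e i)

/-- The Langevin Stein operator `S_p(v) = (1/p) ∑_j ∂_{x^j}(p v^j)`. -/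
def langevin (p : E d → ℝ) (v : E d → E d) (x : E d) : ℝ :=
  1 / p x * ∑ j, partialDeriv j (fun z => p z * v z j) x

/-- The Stein kernel
`k_p(x, y) = 1/(p(x) p(y)) ∑_j ∂_{y^j} ∑_i ∂_{x^i} (p(x) K(x, y)_{ij} p(y))`. -/
def steinKernel (p : E d → ℝ) (K : MatrixKernel d) : Matrix (E d) (E d) (ℝ →L[ℝ] ℝ) :=
  scalarKernel fun x y => 1 / (p x * p y) *
    ∑ j, partialDeriv j (fun y' =>
      ∑ i, partialDeriv i (fun x' => p x' * (K x' y' (e j)) i * p y') x) y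

/-- The score `s_p = ∂ log p`. -/
def score (p : E d → ℝ) (x : E d) : E d :=
  WithLp.toLp 2 fun i => partialDeriv i (fun z => Real.log (p z)) x

/-- The probability measures that finitely integrate `‖s_p‖`. -/
def scoreIntegrating (p : E d → ℝ) : Set (Measure (E d)) :=
  {Q | IsProbabilityMeasure Q ∧ Integrable (fun x => ‖score p x‖) Q}

/-- The target `P` is a probability measure with strictly positive Lebesgue density `p`, and its
Stein RKHS is well defined and has zero mean: `p H_K` consists of partially differentiable
functions, `S_p(H_K) ⊂ L¹(P)` and `P(S_p(H_K)) = {0}`. -/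
structure HasZeroMeanSteinRKHS (K : MatrixKernel d) [Fact K.PosSemidef] (P : Measure (E d))
    (p : E d → ℝ) : Prop where
  isProbabilityMeasure : IsProbabilityMeasure P
  measurable : Measurable p
  pos : ∀ x, 0 < p x
  density : P = volume.withDensity fun x => ENNReal.ofReal (p x)
  partiallyDifferentiable :
    ∀ h : RKHS.OfKernel K, PartiallyDifferentiable fun x => p x • h x
  integrable : ∀ h : RKHS.OfKernel K, Integrable (langevin p fun x => h x) P
  zero_mean : ∀ h : RKHS.OfKernel K, ∫ x, langevin p (fun z => h z) x ∂P = 0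

end Stein

end KSD

end

/-!
Write `s_p = ∂ log p`. Two observations carry the proof.

*The RKHS of the Stein kernel is the image of `H_K` under the Stein operator.* Because the kernel
is characteristic, the Dirac distributions do not vanish on `H_K`, so near any point some component
of some `h ∈ H_K` is nonzero; dividing `p h` by it shows that `p`, and then `log p`, has partial
derivatives (`HasZeroMeanSteinRKHS.partiallyDifferentiable_log`). Hence `S_p h = div h + ⟨s_p, h⟩`
(`langevin_eq_divergence_add_inner`). By Banach–Steinhaus the functionals `h ↦ S_p h (x)` are
continuous on `H_K`, so they are represented by features `ξ x ∈ H_K` (`exists_steinFeature`), and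
`k_p (x, y) = ⟨ξ x, ξ y⟩` (`steinKernel_eq_scalarKernel_inner`). A kernel with a feature map has
the RKHS of the functions `x ↦ ⟨ξ x, g⟩`, which here are the `S_p g`.

*A probability measure `Q` with `∂Q = s_p Q` is `P`.* If `MMD(Q, P) = 0`, then
`∫ S_p g dQ = ∫ S_p g dP = 0` for all `g ∈ H_K`. As `s_p ∈ L¹(Q)`, the functional
`v ↦ ∫ (div v + ⟨s_p, v⟩) dQ` belongs to `D¹_{L¹}`
(`continuous_divInnerLinear`); it annihilates `H_K`, so it is zero, which says that
`∂_j Q = s_p^j Q` weakly for every `j`. Neither is `Q` known to have a density, nor is `p` known to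
be continuous or locally bounded below, so `Q / p` cannot be differentiated directly. Instead `Q`
is disintegrated along the lines parallel to the `j`-th axis. On almost every line the conditional
measure `κ` satisfies `κ' = (log p)' κ`; its density `q` is then continuous, with `q' = (log p)' q`
in the integral sense. Where `q` does not vanish, `(log p)' = q' / q` is locally integrable, so
`log p`, being differentiable everywhere on the line, is locally absolutely continuous there and
`q / p` is locally constant; since `q / p` is continuous, it is constant on the line
(`exists_eq_const_mul_exp`). Thus `Q / p` is invariant under translations along every axis
(`HasLogDerivAlong.map_add_smul_withDensity`), and uniqueness of Haar measure makes it a multiple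
of Lebesgue measure (`eq_of_hasLogDerivAlong`).
-/

noncomputable section

open Set Filter Topology

namespace KSD

/-! ### Weak solutions of a linear differential equation -/

/-- A function which is the integral of an interval integrable function is absolutely continuous. -/
theorem absolutelyContinuousOnInterval_of_sub_eq_integral {f f' : ℝ → ℝ} {a b : ℝ}
    (hf' : IntervalIntegrable f' volume a b) (hf : ∀ t ∈ uIcc a b, f t - f a = ∫ v in a..t, f' v) :
    AbsolutelyContinuousOnInterval f a b := by
  have h1 := hf'.absolutelyContinuousOnInterval_intervalIntegral (left_mem_uIcc)
  rw [absolutelyContinuousOnInterval_iff] at h1 ⊢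
  have key : ∀ t ∈ uIcc a b, ∀ u ∈ uIcc a b,
      dist (∫ v in a..t, f' v) (∫ v in a..u, f' v) = dist (f t) (f u) := fun t ht u hu => by
    rw [← hf t ht, ← hf u hu, dist_sub_right]
  intro ε hε
  obtain ⟨δ, hδ, H⟩ := h1 ε hε
  refine ⟨δ, hδ, fun I hI hI' => ?_⟩
  have := H I hI hI'
  rwa [Finset.sum_congr rfl fun i hi => key _ (hI.1 i hi).1 _ (hI.1 i hi).2] at this

/-- On an interval where `q` does not vanish, `s = (s q) / q` is integrable, so that `q` and
`exp (-g)` are both absolutely continuous and their product has zero derivative. -/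
theorem mul_exp_neg_eq_of_integral_eq {q g s : ℝ → ℝ} (hq : Continuous q)
    (hg : ∀ t, HasDerivAt g (s t) t)
    (hsq : ∀ a b, IntervalIntegrable (fun t => s t * q t) volume a b)
    (h : ∀ a b, q b - q a = ∫ t in a..b, s t * q t) {a b : ℝ}
    (hab : ∀ t ∈ uIcc a b, q t ≠ 0) {t : ℝ} (ht : t ∈ uIcc a b) :
    q t * Real.exp (-g t) = q a * Real.exp (-g a) := by
  have hgc : Continuous g := continuous_iff_continuousAt.2 fun t => (hg t).continuousAt
  have hs : IntervalIntegrable s volume a b := by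
    have h1 := (hsq a b).mul_continuousOn (g := fun t => (q t)⁻¹)
      (hq.continuousOn.inv₀ hab)
    refine h1.congr fun t ht => ?_
    replace ht := uIoc_subset_uIcc ht
    simp [mul_assoc, mul_inv_cancel₀ (hab t ht)]
  have hE : ∀ t, HasDerivAt (fun t => Real.exp (-g t)) (Real.exp (-g t) * (-s t)) t :=
    fun t => (hg t).fun_neg.exp
  have hEac : AbsolutelyContinuousOnInterval (fun t => Real.exp (-g t)) a b := by
    have hi : IntervalIntegrable (fun t => Real.exp (-g t) * (-s t)) volume a b :=
      hs.neg.continuousOn_mul (by fun_prop)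
    exact absolutelyContinuousOnInterval_of_sub_eq_integral hi fun t ht =>
      (intervalIntegral.integral_eq_sub_of_hasDerivAt (fun x _ => hE x)
        (hi.mono_set (uIcc_subset_uIcc left_mem_uIcc ht))).symm
  have hqac : AbsolutelyContinuousOnInterval q a b :=
    absolutelyContinuousOnInterval_of_sub_eq_integral (hsq a b) fun t _ => h a t
  obtain ⟨C, hC⟩ := (hqac.mul hEac).const_of_ae_hasDerivAt_zero (by
    filter_upwards [(hsq a b).ae_hasDerivAt_integral] with t h1 ht
    have h2 : HasDerivAt q (s t * q t) t := by
      have h3 := (h1 ht a left_mem_uIcc).const_add (q a)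
      refine h3.congr_of_eventuallyEq (Eventually.of_forall fun u => ?_)
      change q u = q a + ∫ v in a..u, s v * q v
      rw [← h a u]; ring
    exact (h2.mul (hE t)).congr_deriv (by ring))
  have e1 := hC t ht
  have e2 := hC a left_mem_uIcc
  simp only [Pi.mul_apply] at e1 e2
  rw [e1, e2]

/-- Uniqueness for `q' = g' q`, where the equation holds in the integral sense and `g` is merely
differentiable, so that `g'` need not be locally integrable. The function `q exp (-g)` is continuous
and locally constant where it does not vanish, hence constant. -/
theorem exists_eq_const_mul_exp {q g s : ℝ → ℝ} (hq : Continuous q)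
    (hg : ∀ t, HasDerivAt g (s t) t)
    (hsq : ∀ a b, IntervalIntegrable (fun t => s t * q t) volume a b)
    (h : ∀ a b, q b - q a = ∫ t in a..b, s t * q t) :
    ∃ c, ∀ t, q t = c * Real.exp (g t) := by
  by_cases h0 : ∀ t, q t = 0
  · exact ⟨0, by simpa using h0⟩
  push Not at h0
  obtain ⟨t₀, ht₀⟩ := h0
  have hgc : Continuous g := continuous_iff_continuousAt.2 fun t => (hg t).continuousAt
  set w : ℝ → ℝ := fun t => q t * Real.exp (-g t) with hw
  have hwc : Continuous w := by fun_prop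
  have hclopen : IsClopen {t | w t = w t₀} := by
    refine ⟨isClosed_eq hwc continuous_const, isOpen_iff_mem_nhds.2 fun u hu => ?_⟩
    have hu' : w u = w t₀ := hu
    have hqu : q u ≠ 0 := by
      intro h1
      rw [hw] at hu'
      simp only [h1, zero_mul] at hu'
      exact mul_ne_zero ht₀ (Real.exp_ne_zero _) hu'.symm
    obtain ⟨ε, hε, hball⟩ := Metric.eventually_nhds_iff_ball.1 (hq.continuousAt.eventually_ne hqu)
    refine Filter.mem_of_superset (Metric.ball_mem_nhds u hε) fun t ht => ?_
    have hsub : uIcc u t ⊆ Metric.ball u ε := by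
      rw [← segment_eq_uIcc]
      exact (convex_ball u ε).segment_subset (Metric.mem_ball_self hε) ht
    exact (mul_exp_neg_eq_of_integral_eq hq hg hsq h (fun r hr => hball r (hsub hr))
      right_mem_uIcc).trans hu'
  have huniv := hclopen.eq_univ ⟨t₀, rfl⟩
  refine ⟨w t₀, fun t => ?_⟩
  have : w t = w t₀ := huniv.ge (mem_univ t)
  rw [← this, hw]
  simp only [mul_assoc, ← Real.exp_add]
  simp

/-! ### Measures on the line with a given logarithmic derivative -/

/-- Fubini for the tails `∫_{(u, ∞)} s dκ`: the clamped length `max a (min t b) - a` is the measure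
of the `u ∈ (a, b]` with `u < t`. -/
theorem integral_mul_clamp_eq {κ : Measure ℝ} [IsFiniteMeasure κ] {s : ℝ → ℝ} (hs : Integrable s κ)
    {a b : ℝ} (hab : a ≤ b) :
    ∫ t, s t * (max a (min t b) - a) ∂κ = ∫ u in a..b, ∫ t in Ioi u, s t ∂κ := by
  have h1 : Integrable (fun z : ℝ × ℝ => indicator {z : ℝ × ℝ | z.2 < z.1} (fun z => s z.1) z)
      (κ.prod (volume.restrict (Ioc a b))) :=
    (hs.comp_fst _).indicator (measurableSet_lt measurable_snd measurable_fst)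
  have h2 := integral_integral_swap
    (f := fun t u => indicator {z : ℝ × ℝ | z.2 < z.1} (fun z => s z.1) (t, u)) h1
  rw [intervalIntegral.integral_of_le hab]
  calc _ = ∫ t, (∫ u in Ioc a b,
          indicator {z : ℝ × ℝ | z.2 < z.1} (fun z => s z.1) (t, u)) ∂κ := by
        congr 1
        funext t
        have : (fun u => indicator {z : ℝ × ℝ | z.2 < z.1} (fun z => s z.1) (t, u)) =
            indicator (Iio t) fun _ => s t := by
          funext u; simp [indicator]
        rw [this, integral_indicator measurableSet_Iio, setIntegral_const, smul_eq_mul, mul_comm,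
          measureReal_restrict_apply measurableSet_Iio]
        congr 1
        have : (Iio t ∩ Ioc a b : Set ℝ) =ᵐ[volume] (Ioc a (max a (min t b)) : Set ℝ) := by
          have h3 : (Iio t ∩ Ioc a b : Set ℝ) =ᵐ[volume] (Iic t ∩ Ioc a b : Set ℝ) :=
            ae_eq_set_inter Iio_ae_eq_Iic (ae_eq_refl _)
          rw [show (Ioc a (max a (min t b)) : Set ℝ) = Iic t ∩ Ioc a b from ?_]
          · exact h3
          ext u
          simp only [mem_inter_iff, mem_Iic, mem_Ioc, le_max_iff, le_min_iff]
          constructor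
          · rintro ⟨h1, h2 | h2⟩
            · exact absurd h2 (not_le.2 h1)
            · exact ⟨h2.1, h1, h2.2⟩
          · rintro ⟨h1, h2, h3⟩
            exact ⟨h2, Or.inr ⟨h1, h3⟩⟩
        rw [measureReal_congr this, Real.volume_real_Ioc_of_le (le_max_left _ _)]
    _ = _ := by
        rw [h2]
        congr 1
        funext u
        have : (fun t => indicator {z : ℝ × ℝ | z.2 < z.1} (fun z => s z.1) (t, u)) =
            indicator (Ioi u) s := by
          funext t; simp [indicator]
        rw [this, integral_indicator measurableSet_Ioi]

theorem norm_setIntegral_Ioi_le {κ : Measure ℝ} {s : ℝ → ℝ} (hs : Integrable s κ) (u : ℝ) :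
    ‖∫ t in Ioi u, s t ∂κ‖ ≤ ∫ t, ‖s t‖ ∂κ :=
  (norm_integral_le_integral_norm _).trans
    (setIntegral_le_integral hs.norm (Eventually.of_forall fun _ => norm_nonneg _))

/-- If the mass of every interval with rational ends is bounded by a multiple of its length, there
are no atoms. -/
theorem noAtoms_of_measure_Ioo_rat_le {κ : Measure ℝ} {C : ℝ}
    (h : ∀ a b : ℚ, a < b → κ (Ioo a b) ≤ ENNReal.ofReal (C * (b - a))) : NullSingletonClass κ := by
  refine ⟨fun t => ?_⟩
  refine le_antisymm (ENNReal.le_of_forall_pos_le_add fun ε hε _ => ?_) bot_le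
  rw [zero_add]
  have hC : 0 < |C| + 1 := by positivity
  have hδ : 0 < (ε : ℝ) / (2 * (|C| + 1)) := by positivity
  obtain ⟨a, ha1, ha2⟩ := exists_rat_btwn (sub_lt_self t hδ)
  obtain ⟨b, hb1, hb2⟩ := exists_rat_btwn (lt_add_of_pos_right t hδ)
  have hab : (a : ℝ) < b := ha2.trans hb1
  calc κ {t} ≤ κ (Ioo a b) := measure_mono (by simpa using ⟨ha2, hb1⟩)
    _ ≤ ENNReal.ofReal (C * (b - a)) := h a b (by exact_mod_cast hab)
    _ ≤ ENNReal.ofReal ε := by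
      refine ENNReal.ofReal_le_ofReal ?_
      calc C * (b - a) ≤ (|C| + 1) * (2 * ((ε : ℝ) / (2 * (|C| + 1)))) := by
            refine mul_le_mul (by linarith [le_abs_self C]) (by linarith) (by linarith) hC.le
        _ = ε := by field_simp
    _ = ε := ENNReal.ofReal_coe_nnreal

/-- A finite measure `κ` on the line with `κ' = g' κ` in the weak sense, tested on the primitives
of the indicators of intervals with rational ends, is a multiple of `exp (g t) dt`. -/
theorem exists_eq_smul_withDensity_exp {κ : Measure ℝ} [IsFiniteMeasure κ] {g s : ℝ → ℝ}
    (hg : ∀ t, HasDerivAt g (s t) t) (hs : Integrable s κ)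
    (h : ∀ a b : ℚ, a < b →
      κ.real (Ioo a b) = -∫ t, s t * (max (a : ℝ) (min t b) - a) ∂κ) :
    ∃ c : ℝ≥0∞, κ = c • volume.withDensity fun t => ENNReal.ofReal (Real.exp (g t)) := by
  set q : ℝ → ℝ := fun u => -∫ t in Ioi u, s t ∂κ with hqdef
  set C := ∫ t, ‖s t‖ ∂κ
  have h1 : ∀ a b : ℚ, a < b → κ.real (Ioo a b) = ∫ u in (a : ℝ)..b, q u := fun a b hab => by
    rw [h a b hab, integral_mul_clamp_eq hs (by exact_mod_cast hab.le),
      intervalIntegral.integral_neg]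
  -- by `h1`, the candidate density of `κ` is `q`; it is bounded, so that `κ` has no atoms and `q`
  -- is continuous
  have hqC : ∀ u, ‖q u‖ ≤ C := fun u => by
    rw [hqdef, norm_neg]; exact norm_setIntegral_Ioi_le hs u
  have hatom : NullSingletonClass κ := by
    refine noAtoms_of_measure_Ioo_rat_le (C := C) fun a b hab => ?_
    have hab' : (a : ℝ) < b := by exact_mod_cast hab
    rw [← ofReal_measureReal, h1 a b hab]
    refine ENNReal.ofReal_le_ofReal ((le_abs_self _).trans ?_)
    have := intervalIntegral.norm_integral_le_of_norm_le_const (a := (a : ℝ)) (b := b)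
      (fun u _ => hqC u)
    rwa [abs_of_pos (sub_pos.2 hab')] at this
  have hsub : ∀ a b, q b - q a = ∫ t in a..b, s t ∂κ := fun a b => by
    have := intervalIntegral.integral_Ioi_sub_Ioi' (hs.integrableOn (s := Ioi a))
      (hs.integrableOn (s := Ioi b))
    rw [← this, hqdef]; ring
  have hqc : Continuous q := by
    have h2 := intervalIntegral.continuous_primitive
      (fun a b => (hs.intervalIntegrable : IntervalIntegrable s κ a b)) 0
    have h3 : q = fun b => q 0 + ∫ t in (0 : ℝ)..b, s t ∂κ := by
      funext b; rw [← hsub]; ring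
    rw [h3]; exact continuous_const.add h2
  have hq0 : ∀ u, 0 ≤ q u := by
    intro u
    by_contra! hu
    obtain ⟨ε, hε, hball⟩ := Metric.eventually_nhds_iff_ball.1
      (hqc.continuousAt.eventually_lt_const hu)
    obtain ⟨a, ha1, ha2⟩ := exists_rat_btwn (lt_add_of_pos_right u hε)
    obtain ⟨b, hb1, hb2⟩ := exists_rat_btwn ha2
    have hab : a < b := by exact_mod_cast hb1
    have h2 := h1 a b hab
    have h3 : 0 < ∫ t in (a : ℝ)..b, -q t := by
      refine intervalIntegral.intervalIntegral_pos_of_pos_on (hqc.neg.intervalIntegrable _ _) ?_ hb1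
      intro x hx
      have : q x < 0 := hball x (by
        rw [Metric.mem_ball, Real.dist_eq, abs_lt]; constructor <;> linarith [hx.1, hx.2])
      linarith
    rw [intervalIntegral.integral_neg, ← h2] at h3
    have : 0 ≤ κ.real (Ioo (a : ℝ) b) := measureReal_nonneg
    linarith
  have hκ : κ = volume.withDensity fun t => ENNReal.ofReal (q t) := by
    refine Real.measure_ext_Ioo_rat fun a b => ?_
    rcases le_or_gt b a with hab | hab
    · rw [Ioo_eq_empty (by simpa using hab)]; simp
    · have hab' : (a : ℝ) < b := by exact_mod_cast hab
      rw [withDensity_apply _ measurableSet_Ioo, ← ofReal_measureReal, h1 a b hab,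
        intervalIntegral.integral_of_le hab'.le, ← integral_Ioc_eq_integral_Ioo.symm,
        ← ofReal_integral_eq_lintegral_ofReal]
      · exact hqc.integrableOn_Ioc.mono_set Ioo_subset_Ioc_self
      · exact Eventually.of_forall hq0
  have hsq : Integrable (fun t => s t * q t) volume := by
    rw [hκ] at hs
    rw [integrable_withDensity_iff (by fun_prop) (by simp)] at hs
    simpa [ENNReal.toReal_ofReal (hq0 _)] using hs
  obtain ⟨c, hc⟩ := exists_eq_const_mul_exp hqc hg (fun a b => hsq.intervalIntegrable)
    (fun a b => by
      rw [hsub a b]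
      have hset : ∀ S : Set ℝ, MeasurableSet S → ∫ t in S, s t ∂κ = ∫ t in S, s t * q t :=
        fun S hS => by
          conv_lhs => rw [hκ]
          rw [restrict_withDensity hS,
            integral_withDensity_eq_integral_toReal_smul (by fun_prop) (by simp)]
          simp [ENNReal.toReal_ofReal (hq0 _), mul_comm]
      rw [intervalIntegral, intervalIntegral, hset _ measurableSet_Ioc, hset _ measurableSet_Ioc])
  refine ⟨ENNReal.ofReal c, ?_⟩
  have hc0 : 0 ≤ c := by
    have := hq0 0
    rw [hc] at this
    exact nonneg_of_mul_nonneg_left this (Real.exp_pos _)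
  have hgm : Measurable g :=
    (continuous_iff_continuousAt.2 fun t => (hg t).continuousAt).measurable
  rw [← withDensity_smul _ (by fun_prop)]
  conv_lhs => rw [hκ]
  congr 1
  funext t
  simp [hc, ENNReal.ofReal_mul hc0]

/-! ### Logarithmic derivatives along a direction, tested on products -/

/-- Continuous approximations from below of the indicator of `(a, b)`. -/
def bump (a b : ℝ) (n : ℕ) (t : ℝ) : ℝ :=
  Real.smoothTransition (n * (t - a)) * Real.smoothTransition (n * (b - t))

theorem continuous_bump (a b : ℝ) (n : ℕ) : Continuous (bump a b n) := by
  unfold bump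
  exact (Real.smoothTransition.continuous.comp (by fun_prop)).mul
    (Real.smoothTransition.continuous.comp (by fun_prop))

theorem bump_nonneg (a b : ℝ) (n : ℕ) (t : ℝ) : 0 ≤ bump a b n t :=
  mul_nonneg (Real.smoothTransition.nonneg _) (Real.smoothTransition.nonneg _)

theorem bump_eq_zero {a b t : ℝ} (n : ℕ) (ht : t ∉ Ioo a b) : bump a b n t = 0 := by
  unfold bump
  rcases le_or_gt t a with h | h
  · rw [Real.smoothTransition.zero_of_nonpos
      (mul_nonpos_of_nonneg_of_nonpos n.cast_nonneg (by linarith)), zero_mul]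
  · have : b ≤ t := by
      by_contra! h'
      exact ht ⟨h, h'⟩
    rw [Real.smoothTransition.zero_of_nonpos (x := n * (b - t))
      (mul_nonpos_of_nonneg_of_nonpos n.cast_nonneg (by linarith)), mul_zero]

theorem bump_le_indicator (a b : ℝ) (n : ℕ) (t : ℝ) :
    bump a b n t ≤ indicator (Ioo a b) (fun _ => 1) t := by
  by_cases ht : t ∈ Ioo a b
  · rw [indicator_of_mem ht]
    exact mul_le_one₀ (Real.smoothTransition.le_one _) (Real.smoothTransition.nonneg _)
      (Real.smoothTransition.le_one _)
  · rw [bump_eq_zero n ht, indicator_of_notMem ht]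

theorem bump_le_one (a b : ℝ) (n : ℕ) (t : ℝ) : bump a b n t ≤ 1 :=
  (bump_le_indicator a b n t).trans (indicator_le_self' (by simp) t)

theorem tendsto_bump (a b t : ℝ) :
    Tendsto (fun n => bump a b n t) atTop (𝓝 (indicator (Ioo a b) (fun _ => 1) t)) := by
  by_cases ht : t ∈ Ioo a b
  · rw [indicator_of_mem ht]
    refine tendsto_const_nhds.congr' ?_
    have key : ∀ c : ℝ, 0 < c → ∀ᶠ n : ℕ in atTop, 1 ≤ n * c := fun c hc =>
      (tendsto_natCast_atTop_atTop.atTop_mul_const hc).eventually_ge_atTop 1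
    filter_upwards [key _ (sub_pos.2 ht.1), key _ (sub_pos.2 ht.2)] with n h1 h2
    rw [bump, Real.smoothTransition.one_of_one_le h1, Real.smoothTransition.one_of_one_le h2,
      one_mul]
  · simp only [bump_eq_zero _ ht, indicator_of_notMem ht]
    exact tendsto_const_nhds

theorem integral_indicator_Ioo {a b : ℝ} (hab : a ≤ b) (t : ℝ) :
    ∫ u in a..t, indicator (Ioo a b) (fun _ => (1 : ℝ)) u = max a (min t b) - a := by
  rcases le_total a t with h | h
  · rw [intervalIntegral.integral_of_le h, setIntegral_indicator measurableSet_Ioo,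
      setIntegral_const, smul_eq_mul, mul_one, max_eq_right (le_min h hab)]
    have : (Ioc a t ∩ Ioo a b : Set ℝ) =ᵐ[volume] (Ioc a (min t b) : Set ℝ) := by
      have h3 : (Ioc a t ∩ Ioo a b : Set ℝ) =ᵐ[volume] (Ioc a t ∩ Ioc a b : Set ℝ) :=
        ae_eq_set_inter (ae_eq_refl _) Ioo_ae_eq_Ioc
      rwa [Ioc_inter_Ioc, max_self] at h3
    rw [measureReal_congr this, Real.volume_real_Ioc_of_le (le_min h hab)]
  · rw [intervalIntegral.integral_of_ge h, setIntegral_indicator measurableSet_Ioo,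
      max_eq_left ((min_le_left _ _).trans h)]
    have : (Ioc t a ∩ Ioo a b : Set ℝ) = ∅ := by
      ext u; simp only [mem_inter_iff, mem_Ioc, mem_Ioo, mem_empty_iff_false, iff_false]
      rintro ⟨h1, h2⟩
      linarith [h1.2, h2.1]
    simp [this]

theorem integrable_indicator_Ioo (a b : ℝ) :
    Integrable (indicator (Ioo a b) fun _ => (1 : ℝ)) :=
  (integrable_indicator_iff measurableSet_Ioo).2 (by simp)

theorem abs_integral_bump_le {a b : ℝ} (hab : a ≤ b) (n : ℕ) (t : ℝ) :
    |∫ u in a..t, bump a b n u| ≤ b - a := by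
  have hi := integrable_indicator_Ioo a b
  have h1 : ∀ u, ‖bump a b n u‖ ≤ indicator (Ioo a b) (fun _ => (1 : ℝ)) u := fun u => by
    rw [Real.norm_of_nonneg (bump_nonneg _ _ _ _)]; exact bump_le_indicator a b n u
  rw [← Real.norm_eq_abs]
  calc ‖∫ u in a..t, bump a b n u‖ ≤ ∫ u in uIoc a t, ‖bump a b n u‖ :=
        intervalIntegral.norm_integral_le_integral_norm_uIoc
    _ ≤ ∫ u, ‖bump a b n u‖ :=
        setIntegral_le_integral
          (hi.mono' (continuous_bump a b n).norm.aestronglyMeasurable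
            (Eventually.of_forall fun u => by rw [norm_norm]; exact h1 u))
          (Eventually.of_forall fun _ => norm_nonneg _)
    _ ≤ ∫ u, indicator (Ioo a b) (fun _ => (1 : ℝ)) u :=
        integral_mono_of_nonneg (Eventually.of_forall fun _ => norm_nonneg _) hi
          (Eventually.of_forall h1)
    _ = b - a := by
        rw [integral_indicator measurableSet_Ioo, setIntegral_const, smul_eq_mul, mul_one,
          Real.volume_real_Ioo_of_le hab]

theorem tendsto_integral_bump {a b : ℝ} (hab : a ≤ b) (t : ℝ) :
    Tendsto (fun n => ∫ u in a..t, bump a b n u) atTop (𝓝 (max a (min t b) - a)) := by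
  rw [← integral_indicator_Ioo hab]
  refine intervalIntegral.tendsto_integral_filter_of_dominated_convergence (fun _ => 1) ?_ ?_ ?_ ?_
  · exact Eventually.of_forall fun n => (continuous_bump a b n).aestronglyMeasurable
  · refine Eventually.of_forall fun n => Eventually.of_forall fun u _ => ?_
    rw [Real.norm_of_nonneg (bump_nonneg _ _ _ _)]; exact bump_le_one _ _ _ _
  · simp
  · exact Eventually.of_forall fun u _ => tendsto_bump a b u

section Direction

variable {V : Type*} [NormedAddCommGroup V] [NormedSpace ℝ V]

/-- The measure `Q` satisfies `∂_e Q = s Q` in the weak sense, against bounded `C¹` functions with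
bounded derivative. -/
def HasLogDerivAlong [MeasurableSpace V] (Q : Measure V) (e : V) (s : V → ℝ) : Prop :=
  ∀ φ : V → ℝ, ContDiff ℝ 1 φ → (∃ C, ∀ x, ‖φ x‖ ≤ C) → (∃ C, ∀ x, ‖fderiv ℝ φ x‖ ≤ C) →
    ∫ x, (fderiv ℝ φ x e + s x * φ x) ∂Q = 0

variable [MeasurableSpace V] [BorelSpace V] {Q : Measure V} [IsFiniteMeasure Q] {e : V}
  {s : V → ℝ}

/-- A weak logarithmic derivative along `e` may be tested on functions of the form
`ψ(x - ℓ(x) e) B(ℓ(x))` with `B` the primitive of the indicator of an interval. -/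
theorem HasLogDerivAlong.integral_indicator_eq_zero (hQ : HasLogDerivAlong Q e s)
    (hs : Integrable s Q) {ℓ : V →L[ℝ] ℝ} (hℓ : ℓ e = 1) {ψ : V → ℝ} (hψ : ContDiff ℝ 1 ψ)
    (hψb : ∃ C, ∀ x, ‖ψ x‖ ≤ C) (hψb' : ∃ C, ∀ x, ‖fderiv ℝ ψ x‖ ≤ C) {a b : ℝ} (hab : a ≤ b) :
    ∫ x, ψ (x - ℓ x • e) * (indicator (Ioo a b) (fun _ => 1) (ℓ x)
      + s x * (max a (min (ℓ x) b) - a)) ∂Q = 0 := by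
  obtain ⟨M, hM⟩ := hψb
  obtain ⟨M', hM'⟩ := hψb'
  set π : V →L[ℝ] V := ContinuousLinearMap.id ℝ V - ℓ.smulRight e with hπ
  have hπe : π e = 0 := by simp [hπ, hℓ]
  have hπx : ∀ x, π x = x - ℓ x • e := fun x => rfl
  simp only [← hπx]
  have hM0 : 0 ≤ M := (norm_nonneg _).trans (hM 0)
  set B : ℕ → ℝ → ℝ := fun n t => ∫ u in a..t, bump a b n u with hB
  have hBd : ∀ n t, HasDerivAt (B n) (bump a b n t) t := fun n t =>
    (continuous_bump a b n).integral_hasStrictDerivAt a t |>.hasDerivAt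
  have hBc : ∀ n, ContDiff ℝ 1 (B n) := fun n => by
    rw [contDiff_one_iff_deriv]
    refine ⟨fun t => (hBd n t).differentiableAt, ?_⟩
    rw [show deriv (B n) = bump a b n from funext fun t => (hBd n t).deriv]
    exact continuous_bump a b n
  have hfd : ∀ n x, HasFDerivAt (fun x => ψ (π x) * B n (ℓ x))
      (ψ (π x) • (bump a b n (ℓ x) • ℓ) + B n (ℓ x) • ((fderiv ℝ ψ (π x)).comp π)) x := by
    intro n x
    have h1 : HasFDerivAt (fun x => ψ (π x)) ((fderiv ℝ ψ (π x)).comp π) x :=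
      ((hψ.differentiable one_ne_zero (π x)).hasFDerivAt).comp x π.hasFDerivAt
    have h2 : HasFDerivAt (fun x => B n (ℓ x)) (bump a b n (ℓ x) • ℓ) x :=
      (hBd n (ℓ x)).comp_hasFDerivAt x ℓ.hasFDerivAt
    exact h1.mul h2
  have hzero : ∀ n, ∫ x, ψ (π x) * (bump a b n (ℓ x) + s x * B n (ℓ x)) ∂Q = 0 := by
    intro n
    rw [← hQ (fun x => ψ (π x) * B n (ℓ x)) ((hψ.comp π.contDiff).mul ((hBc n).comp ℓ.contDiff))
      ⟨M * (b - a), fun x => ?_⟩ ⟨M * ‖ℓ‖ + (b - a) * (M' * ‖π‖), fun x => ?_⟩]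
    · congr 1
      funext x
      rw [(hfd n x).fderiv]
      simp [hπe, hℓ]
      ring
    · rw [norm_mul]
      exact mul_le_mul (hM _) (abs_integral_bump_le hab n _) (norm_nonneg _) hM0
    · rw [(hfd n x).fderiv]
      refine (norm_add_le _ _).trans (add_le_add ?_ ?_)
      · rw [norm_smul, norm_smul]
        refine mul_le_mul (hM _) ?_ (by positivity) hM0
        rw [Real.norm_of_nonneg (bump_nonneg _ _ _ _)]
        exact mul_le_of_le_one_left (norm_nonneg _) (bump_le_one _ _ _ _)
      · rw [norm_smul]
        refine mul_le_mul (abs_integral_bump_le hab n _) ?_ (norm_nonneg _) (sub_nonneg.2 hab)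
        exact (ContinuousLinearMap.opNorm_comp_le _ _).trans
          (mul_le_mul_of_nonneg_right (hM' _) (norm_nonneg _))
  have hlim : Tendsto (fun n => ∫ x, ψ (π x) * (bump a b n (ℓ x) + s x * B n (ℓ x)) ∂Q) atTop
      (𝓝 (∫ x, ψ (π x) * (indicator (Ioo a b) (fun _ => 1) (ℓ x)
        + s x * (max a (min (ℓ x) b) - a)) ∂Q)) := by
    refine tendsto_integral_of_dominated_convergence
      (fun x => M * (1 + ‖s x‖ * (b - a))) ?_ ?_ ?_ ?_
    · intro n
      have h1 : Continuous fun x => ψ (π x) := hψ.continuous.comp π.continuous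
      have h2 : Continuous fun x => bump a b n (ℓ x) := (continuous_bump a b n).comp ℓ.continuous
      have h3 : Continuous fun x => B n (ℓ x) := (hBc n).continuous.comp ℓ.continuous
      exact h1.aestronglyMeasurable.mul (h2.aestronglyMeasurable.add
        (hs.1.mul h3.aestronglyMeasurable))
    · exact ((integrable_const 1).add (hs.norm.mul_const _)).const_mul M
    · intro n
      refine Eventually.of_forall fun x => ?_
      rw [norm_mul]
      refine mul_le_mul (hM _) ((norm_add_le _ _).trans (add_le_add ?_ ?_)) (norm_nonneg _) hM0
      · rw [Real.norm_of_nonneg (bump_nonneg _ _ _ _)]; exact bump_le_one _ _ _ _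
      · rw [norm_mul]
        exact mul_le_mul_of_nonneg_left (abs_integral_bump_le hab n _) (norm_nonneg _)
    · refine Eventually.of_forall fun x => ?_
      exact ((tendsto_bump a b _).add ((tendsto_integral_bump hab _).const_mul _)).const_mul _
  simp only [hzero] at hlim
  exact tendsto_nhds_unique hlim tendsto_const_nhds

end Direction

/-! ### Disintegration along lines and translation invariance -/

section Disintegration

variable {V : Type*} [NormedAddCommGroup V] [NormedSpace ℝ V] [FiniteDimensional ℝ V]
  [MeasurableSpace V] [BorelSpace V] {Q : Measure V} [IsFiniteMeasure Q] {e : V} {g s : V → ℝ}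

/-- Disintegrate `Q` along the lines of direction `e`: if `∂_e Q = (∂_e g) Q` weakly, then almost
every conditional measure is a multiple of `exp (g (y + t e)) dt`. The lines are parametrized by
their points `y` with `ℓ y = 0`, and `x ↦ (x - ℓ x • e, ℓ x)` has the left inverse
`(y, t) ↦ y + t • e`. -/
theorem HasLogDerivAlong.ae_condKernel_eq (hQ : HasLogDerivAlong Q e s) (hsm : Measurable s)
    (hs : Integrable s Q) (hg : ∀ x, HasDerivAt (fun t : ℝ => g (x + t • e)) (s x) 0)
    {ℓ : V →L[ℝ] ℝ} (hℓ : ℓ e = 1) :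
    ∀ᵐ y ∂(Q.map fun x => (x - ℓ x • e, ℓ x)).fst, ∃ c : ℝ≥0∞,
      (Q.map fun x => (x - ℓ x • e, ℓ x)).condKernel y =
        c • volume.withDensity fun t : ℝ => ENNReal.ofReal (Real.exp (g (y + t • e))) := by
  have hproper : ProperSpace V := FiniteDimensional.proper_real V
  have hι : Measurable fun x : V => (x - ℓ x • e, ℓ x) :=
    Measurable.prodMk (by fun_prop) (by fun_prop)
  set ρ := Q.map fun x => (x - ℓ x • e, ℓ x) with hρ
  have hfin : IsFiniteMeasure ρ := by rw [hρ]; infer_instance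
  have hσ : Measurable fun z : V × ℝ => z.1 + z.2 • e := by fun_prop
  have hσι : ∀ x : V, x - ℓ x • e + ℓ x • e = x := fun x => sub_add_cancel _ _
  have hsσ : Integrable (fun z : V × ℝ => s (z.1 + z.2 • e)) ρ := by
    refine (integrable_map_measure (hsm.comp hσ).aestronglyMeasurable hι.aemeasurable).2 ?_
    simpa [Function.comp_def, hσι] using hs
  -- the test on products `ψ(y) B(t)`, for all `ψ`, localizes to almost every line; intervals with
  -- rational ends keep the exceptional set null
  have hrat : ∀ᵐ y ∂ρ.fst, ∀ a b : ℚ, a < b →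
      ∫ t, (indicator (Ioo (a : ℝ) b) (fun _ => (1 : ℝ)) t
        + s (y + t • e) * (max (a : ℝ) (min t b) - a)) ∂ρ.condKernel y = 0 := by
    rw [ae_all_iff]; intro a
    rw [ae_all_iff]; intro b
    by_cases hab : a < b
    swap
    · exact Eventually.of_forall fun _ h => absurd h hab
    have hab' : (a : ℝ) < b := by exact_mod_cast hab
    have hi : Integrable (fun z : V × ℝ => indicator (Ioo (a : ℝ) b) (fun _ => (1 : ℝ)) z.2
        + s (z.1 + z.2 • e) * (max (a : ℝ) (min z.2 b) - a)) ρ := by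
      refine Integrable.add ?_ ?_
      · refine (integrable_const (1 : ℝ)).mono' ?_ (Eventually.of_forall fun z => ?_)
        · exact ((measurable_const.indicator measurableSet_Ioo).comp
            measurable_snd).aestronglyMeasurable
        · by_cases h : z.2 ∈ Ioo (a : ℝ) b <;> simp [h]
      · refine hsσ.mul_bdd (c := b - a) (by fun_prop) (Eventually.of_forall fun z => ?_)
        rw [Real.norm_eq_abs, abs_le]
        constructor
        · linarith [le_max_left (a : ℝ) (min z.2 b)]
        · linarith [max_le hab'.le (min_le_right z.2 b)]
    have h0 := ae_eq_zero_of_integral_contDiff_smul_eq_zero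
      (μ := ρ.fst) hi.integral_condKernel.locallyIntegrable fun ψ hψ hψc => ?_
    · filter_upwards [h0] with y hy _ using hy
    · obtain ⟨M, hM⟩ := hψc.exists_bound_of_continuous hψ.continuous
      obtain ⟨M', hM'⟩ := (hψc.fderiv ℝ).exists_bound_of_continuous
        (hψ.continuous_fderiv (by simp))
      have hψi : Integrable (fun z : V × ℝ =>
          ψ z.1 * (indicator (Ioo (a : ℝ) b) (fun _ => (1 : ℝ)) z.2 +
            s (z.1 + z.2 • e) * (max (a : ℝ) (min z.2 b) - a))) ρ :=
        hi.bdd_mul (c := M) (hψ.continuous.comp continuous_fst).aestronglyMeasurable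
          (Eventually.of_forall fun z => hM z.1)
      have h1 := Measure.integral_condKernel hψi
      have h2 := hQ.integral_indicator_eq_zero hs hℓ (hψ.of_le (by simp)) ⟨M, hM⟩ ⟨M', hM'⟩ hab'.le
      have h3 := integral_map hι.aemeasurable hψi.1
      simp only [hσι, h2] at h3
      rw [← h1.trans h3]
      congr 1
      funext y
      exact (integral_const_mul _ _).symm
  filter_upwards [hrat, hsσ.condKernel_ae] with y hy hsy
  have hgy : ∀ t : ℝ, HasDerivAt (fun t : ℝ => g (y + t • e)) (s (y + t • e)) t := fun t => by
    have h1 := hg (y + t • e)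
    rw [← sub_self t] at h1
    refine (h1.comp_sub_const t t).congr_of_eventuallyEq (Eventually.of_forall fun u => ?_)
    simp only [add_assoc, ← add_smul]
    congr 3; ring
  refine exists_eq_smul_withDensity_exp hgy hsy fun a b hab => ?_
  have hab' : (a : ℝ) < b := by exact_mod_cast hab
  have h1 := hy a b hab
  rw [integral_add, integral_indicator measurableSet_Ioo, setIntegral_const, smul_eq_mul,
    mul_one] at h1
  · linarith
  · exact (integrable_const (1 : ℝ)).indicator measurableSet_Ioo
  · refine hsy.mul_bdd (c := b - a) (by fun_prop) (Eventually.of_forall fun z => ?_)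
    rw [Real.norm_eq_abs, abs_le]
    constructor
    · linarith [le_max_left (a : ℝ) (min z b)]
    · linarith [max_le hab'.le (min_le_right z b)]

/-- If `∂_e Q = (∂_e g) Q` weakly, then `exp (-g) Q` is invariant under translations along `e`. -/
theorem HasLogDerivAlong.map_add_smul_withDensity (hQ : HasLogDerivAlong Q e s)
    (hsm : Measurable s) (hs : Integrable s Q) (hgm : Measurable g)
    (hg : ∀ x, HasDerivAt (fun t : ℝ => g (x + t • e)) (s x) 0)
    {ℓ : V →L[ℝ] ℝ} (hℓ : ℓ e = 1) (τ : ℝ) :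
    (Q.withDensity fun x => ENNReal.ofReal (Real.exp (-g x))).map (fun x => τ • e + x) =
      Q.withDensity fun x => ENNReal.ofReal (Real.exp (-g x)) := by
  have hproper : ProperSpace V := FiniteDimensional.proper_real V
  have hι : Measurable fun x : V => (x - ℓ x • e, ℓ x) :=
    Measurable.prodMk (by fun_prop) (by fun_prop)
  have hae := hQ.ae_condKernel_eq hsm hs hg hℓ
  set ρ := Q.map fun x => (x - ℓ x • e, ℓ x) with hρ
  have hfin : IsFiniteMeasure ρ := by rw [hρ]; infer_instance
  have hσι : ∀ x : V, x - ℓ x • e + ℓ x • e = x := fun x => sub_add_cancel _ _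
  -- `∫ F e^{-g} dQ` through the disintegration of `Q`
  have hdis : ∀ F : V → ℝ≥0∞, Measurable F →
      ∫⁻ x, F x ∂Q.withDensity (fun x => ENNReal.ofReal (Real.exp (-g x))) =
        ∫⁻ y, ∫⁻ t, ENNReal.ofReal (Real.exp (-g (y + t • e))) * F (y + t • e)
          ∂ρ.condKernel y ∂ρ.fst := by
    intro F hF
    have hm : Measurable fun z : V × ℝ =>
        ENNReal.ofReal (Real.exp (-g (z.1 + z.2 • e))) * F (z.1 + z.2 • e) := by fun_prop
    rw [Measure.lintegral_condKernel hm, hρ, lintegral_map hm hι,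
      lintegral_withDensity_eq_lintegral_mul _ (by fun_prop) hF]
    simp [hσι]
  have hfib : ∀ (y : V) (c : ℝ≥0∞) (F : V → ℝ≥0∞), Measurable F →
      ∫⁻ t, ENNReal.ofReal (Real.exp (-g (y + t • e))) * F (y + t • e)
        ∂(c • volume.withDensity fun t : ℝ => ENNReal.ofReal (Real.exp (g (y + t • e)))) =
      c * ∫⁻ t : ℝ, F (y + t • e) := by
    intro y c F hF
    rw [lintegral_smul_measure, lintegral_withDensity_eq_lintegral_mul _ (by fun_prop)
      (by fun_prop), smul_eq_mul]
    congr 2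
    funext t
    simp only [Pi.mul_apply]
    rw [← mul_assoc, ← ENNReal.ofReal_mul (Real.exp_pos _).le, ← Real.exp_add]
    simp
  refine Measure.ext_of_lintegral _ fun F hF => ?_
  have hFτ : Measurable fun x => F (τ • e + x) := by fun_prop
  rw [lintegral_map hF (by fun_prop), hdis _ hFτ, hdis _ hF]
  refine lintegral_congr_ae ?_
  filter_upwards [hae] with y ⟨c, hc⟩
  rw [hc, hfib y c _ hF, hfib y c _ hFτ,
    ← lintegral_add_right_eq_self (fun t : ℝ => F (y + t • e)) τ]
  congr 2
  funext t
  congr 1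
  rw [add_smul]; abel

end Disintegration

/-! ### Determination of a probability measure by its score -/

/-- The partial derivatives of a measurable function are measurable where they exist everywhere:
they are pointwise limits of difference quotients. No continuity of the function is needed. -/
theorem measurable_lineDeriv_of_lineDifferentiable {V : Type*} [NormedAddCommGroup V]
    [NormedSpace ℝ V] [MeasurableSpace V] [BorelSpace V] {f : V → ℝ} (hf : Measurable f) {v : V}
    (hd : ∀ x, LineDifferentiableAt ℝ f x v) : Measurable fun x => lineDeriv ℝ f x v := by
  refine measurable_of_tendsto_metrizable
    (f := fun (n : ℕ) x => ((n : ℝ) + 1) * (f (x + ((n : ℝ) + 1)⁻¹ • v) - f x))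
    (fun n => by fun_prop) ?_
  rw [tendsto_pi_nhds]
  intro x
  have h1 := (hd x).hasLineDerivAt.tendsto_slope_zero
  have h2 : Tendsto (fun n : ℕ => ((n : ℝ) + 1)⁻¹) atTop (𝓝[≠] 0) := by
    refine tendsto_nhdsWithin_iff.2 ⟨?_, Eventually.of_forall fun n => ?_⟩
    · simpa using tendsto_one_div_add_atTop_nhds_zero_nat (𝕜 := ℝ)
    · simp only [mem_compl_iff, mem_singleton_iff]; positivity
  refine (h1.comp h2).congr fun n => ?_
  simp

theorem hasDerivAt_log_line {d : ℕ} {p : E d → ℝ}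
    (hlog : PartiallyDifferentiable fun x => Real.log (p x)) (x : E d) (i : Fin d) :
    HasDerivAt (fun t : ℝ => Real.log (p (x + t • e i))) (score p x i) 0 :=
  (hlog x i).hasLineDerivAt

theorem measurable_score {d : ℕ} {p : E d → ℝ} (hp : Measurable p)
    (hlog : PartiallyDifferentiable fun x => Real.log (p x)) : Measurable (score p) := by
  refine (WithLp.measurable_toLp 2 (Fin d → ℝ)).comp (measurable_pi_lambda _ fun i => ?_)
  exact measurable_lineDeriv_of_lineDifferentiable (Real.measurable_log.comp hp)
    fun x => hlog x i

theorem sum_smul_e {d : ℕ} (v : E d) : ∑ i, v i • (e i : E d) = v := by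
  simpa using (EuclideanSpace.basisFun (Fin d) ℝ).sum_repr v

/-- A measure on `ℝᵈ` that is invariant under translations along the axes is translation
invariant. -/
theorem isAddLeftInvariant_of_map_single {d : ℕ} {ν : Measure (E d)}
    (h : ∀ (i : Fin d) (τ : ℝ), ν.map (fun x => τ • e i + x) = ν) : ν.IsAddLeftInvariant := by
  refine ⟨fun v => ?_⟩
  rw [← sum_smul_e v]
  refine Finset.sum_induction _ (fun w : E d => ν.map (fun x => w + x) = ν) ?_ (by simp)
    fun i _ => h i (v i)
  intro a b ha hb
  have : (fun x : E d => a + b + x) = (fun x => a + x) ∘ fun x => b + x := by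
    funext x; simp [add_assoc]
  rw [this, ← Measure.map_map (by fun_prop) (by fun_prop), hb, ha]

/-- A positive density with partial derivatives is determined by its score among all
probability measures. -/
theorem eq_of_hasLogDerivAlong {d : ℕ} {p : E d → ℝ} (hp : Measurable p) (hpos : ∀ x, 0 < p x)
    (hlog : PartiallyDifferentiable fun x => Real.log (p x)) {P Q : Measure (E d)}
    [IsProbabilityMeasure P] [IsProbabilityMeasure Q]
    (hP : P = volume.withDensity fun x => ENNReal.ofReal (p x))
    (hs : Integrable (score p) Q) (hQ : ∀ i, HasLogDerivAlong Q (e i) fun x => score p x i) :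
    Q = P := by
  set ν := Q.withDensity fun x => ENNReal.ofReal (Real.exp (-Real.log (p x))) with hν
  have hinv : ν.IsAddLeftInvariant := by
    refine isAddLeftInvariant_of_map_single fun i τ => ?_
    refine (hQ i).map_add_smul_withDensity
      ((EuclideanSpace.proj (𝕜 := ℝ) i).measurable.comp (measurable_score hp hlog)) ?_
      (Real.measurable_log.comp hp)
      (fun x => hasDerivAt_log_line hlog x i) (ℓ := EuclideanSpace.proj i) (by simp) τ
    exact (EuclideanSpace.proj (𝕜 := ℝ) i).integrable_comp hs
  have hσ : SigmaFinite ν := SigmaFinite.withDensity_ofReal _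
  obtain ⟨c, hc⟩ : ∃ c : ℝ≥0∞, ν = c • volume :=
    ⟨_, measure_eq_sub_vadd (s := Metric.ball (0 : E d) 1) ν volume
      (Metric.measure_ball_pos volume _ one_pos).ne' measure_ball_lt_top.ne⟩
  have hQν : Q = ν.withDensity fun x => ENNReal.ofReal (p x) := by
    rw [hν, ← withDensity_mul _ (by fun_prop) (by fun_prop)]
    conv_lhs => rw [← withDensity_one (μ := Q)]
    congr 1
    funext x
    simp only [Pi.mul_apply, Pi.one_apply]
    rw [← ENNReal.ofReal_mul (Real.exp_pos _).le, Real.exp_neg, Real.exp_log (hpos x),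
      inv_mul_cancel₀ (hpos x).ne', ENNReal.ofReal_one]
  have hQP : Q = c • P := by
    rw [hQν, hc, withDensity_smul_measure, hP]
  have h1 : c = 1 := by
    have := congrArg (fun μ : Measure (E d) => μ univ) hQP
    simpa using this.symm
  rw [hQP, h1, one_smul]

/-! ### First-order distributions dual to the strict topology -/

/-- For every finite measure there is a weight vanishing at infinity whose inverse is integrable: a
series `∑ 2⁻ⁿ χₙ` of cut-offs `χₙ` at radii that grow fast enough. -/
theorem exists_zeroAtInfty_lintegral_inv_lt_top {V : Type*} [NormedAddCommGroup V] [ProperSpace V]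
    [MeasurableSpace V] [BorelSpace V] (ν : Measure V) [IsFiniteMeasure ν] :
    ∃ γ : C₀(V, ℝ), (∀ x, 0 < γ x) ∧ ∫⁻ x, ENNReal.ofReal (γ x)⁻¹ ∂ν < ∞ := by
  -- the radii `R n` below are such that the mass beyond them is at most `2⁻²ⁿ⁻¹`
  have htail : Tendsto (fun N : ℕ => ν {x | (N : ℝ) < ‖x‖}) atTop (𝓝 0) := by
    have h1 := tendsto_measure_iInter_atTop (μ := ν) (s := fun N : ℕ => {x : V | (N : ℝ) < ‖x‖})
      (fun N => (measurableSet_lt measurable_const measurable_norm).nullMeasurableSet)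
      (fun m n hmn x (hx : (n : ℝ) < ‖x‖) =>
        show (m : ℝ) < ‖x‖ from (Nat.cast_le.2 hmn).trans_lt hx) ⟨0, measure_ne_top _ _⟩
    have h2 : (⋂ N : ℕ, {x : V | (N : ℝ) < ‖x‖}) = ∅ := by
      refine eq_empty_of_forall_notMem fun x hx => ?_
      obtain ⟨N, hN⟩ := exists_nat_ge ‖x‖
      exact absurd (mem_iInter.1 hx N) (not_lt.2 hN)
    rwa [h2, measure_empty] at h1
  have hR : ∀ n : ℕ, ∃ N : ℕ, n ≤ N ∧ 2 ^ (n + 1) * ν {x | (N : ℝ) < ‖x‖} ≤ 2⁻¹ ^ n := by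
    intro n
    have h1 : Tendsto (fun N : ℕ => (2 : ℝ≥0∞) ^ (n + 1) * ν {x | (N : ℝ) < ‖x‖}) atTop (𝓝 0) := by
      simpa using ENNReal.Tendsto.const_mul htail
        (Or.inr (ENNReal.pow_ne_top (n := n + 1) (ENNReal.ofNat_ne_top (n := 2))))
    have h2 : (0 : ℝ≥0∞) < 2⁻¹ ^ n := ENNReal.pow_pos (by simp) n
    obtain ⟨N, h3, h4⟩ := ((h1.eventually_lt_const h2).and (eventually_ge_atTop n)).exists
    exact ⟨N, h4, h3.le⟩
  choose R hnR hR using hR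
  set χ : ℕ → V → ℝ := fun n x => max 0 (min 1 (R n + 1 - ‖x‖)) with hχ
  have hχ0 : ∀ n x, 0 ≤ χ n x := fun n x => le_max_left _ _
  have hχ1 : ∀ n x, χ n x ≤ 1 := fun n x => max_le zero_le_one (min_le_left _ _)
  have hχone : ∀ n x, ‖x‖ ≤ R n → χ n x = 1 := fun n x hx => by
    rw [hχ]; simp only; rw [min_eq_left (by linarith), max_eq_right zero_le_one]
  have hχzero : ∀ n x, (R n : ℝ) + 1 ≤ ‖x‖ → χ n x = 0 := fun n x hx => by
    rw [hχ]; simp only; exact max_eq_left ((min_le_right _ _).trans (by linarith))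
  have hterm0 : ∀ n x, 0 ≤ (1 / 2 : ℝ) ^ n * χ n x := fun n x =>
    mul_nonneg (by positivity) (hχ0 n x)
  have hterm : ∀ n x, ‖(1 / 2 : ℝ) ^ n * χ n x‖ ≤ (1 / 2) ^ n := fun n x => by
    rw [Real.norm_of_nonneg (hterm0 n x)]
    exact mul_le_of_le_one_right (by positivity) (hχ1 n x)
  have hsum : ∀ x, Summable fun n => (1 / 2 : ℝ) ^ n * χ n x := fun x =>
    Summable.of_norm_bounded summable_geometric_two fun n => hterm n x
  have hcont : Continuous fun x => ∑' n, (1 / 2 : ℝ) ^ n * χ n x :=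
    continuous_tsum (fun n => by fun_prop) summable_geometric_two hterm
  have hinf : Tendsto (fun x => ∑' n, (1 / 2 : ℝ) ^ n * χ n x) (cocompact V) (𝓝 0) := by
    have := tendsto_tsum_of_dominated_convergence (𝓕 := cocompact V)
      (f := fun x n => (1 / 2 : ℝ) ^ n * χ n x) (g := fun _ => 0) summable_geometric_two
      (fun n => by
        refine tendsto_const_nhds.congr' ?_
        filter_upwards [tendsto_norm_cocompact_atTop.eventually_ge_atTop ((R n : ℝ) + 1)] with x hx
        rw [hχzero n x hx, mul_zero]) (Eventually.of_forall fun x n => hterm n x)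
    simpa using this
  have hlow : ∀ n x, ‖x‖ ≤ R n → (1 / 2 : ℝ) ^ n ≤ ∑' n, (1 / 2 : ℝ) ^ n * χ n x := fun n x hx => by
    refine le_trans ?_ ((hsum x).le_tsum n fun m _ => hterm0 m x)
    rw [hχone n x hx, mul_one]
  have hex : ∀ x : V, ∃ n : ℕ, ‖x‖ ≤ R n := fun x => by
    obtain ⟨N, hN⟩ := exists_nat_ge ‖x‖
    exact ⟨N, hN.trans (Nat.cast_le.2 (hnR N))⟩
  refine ⟨⟨⟨fun x => ∑' n, (1 / 2 : ℝ) ^ n * χ n x, hcont⟩, hinf⟩, fun x => ?_, ?_⟩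
  · obtain ⟨n, hn⟩ := hex x
    exact lt_of_lt_of_le (by positivity) (hlow n x hn)
  · change ∫⁻ x, ENNReal.ofReal (∑' n, (1 / 2 : ℝ) ^ n * χ n x)⁻¹ ∂ν < ∞
    have hmeas : ∀ n, MeasurableSet {x : V | (R n : ℝ) < ‖x‖} := fun n =>
      measurableSet_lt measurable_const measurable_norm
    have hbound : ∀ x, ENNReal.ofReal (∑' n, (1 / 2 : ℝ) ^ n * χ n x)⁻¹ ≤
        1 + ∑' n, indicator {x : V | (R n : ℝ) < ‖x‖} (fun _ => (2 : ℝ≥0∞) ^ (n + 1)) x := by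
      intro x
      classical
      have hn := Nat.find_spec (hex x)
      have h1 : (∑' n, (1 / 2 : ℝ) ^ n * χ n x)⁻¹ ≤ 2 ^ Nat.find (hex x) := by
        refine (inv_anti₀ (by positivity) (hlow _ x hn)).trans ?_
        rw [one_div, inv_pow, inv_inv]
      have h2 : ENNReal.ofReal (∑' n, (1 / 2 : ℝ) ^ n * χ n x)⁻¹ ≤ 2 ^ Nat.find (hex x) := by
        refine (ENNReal.ofReal_le_ofReal h1).trans ?_
        rw [ENNReal.ofReal_pow zero_le_two]; simp
      refine h2.trans ?_
      rcases h : Nat.find (hex x) with _ | m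
      · simp
      · have hm : ¬ ‖x‖ ≤ R m := Nat.find_min (hex x) (by omega)
        refine le_trans ?_ (le_add_self)
        refine le_trans ?_ (ENNReal.le_tsum m)
        rw [indicator_of_mem (by simpa using hm)]
    refine (lintegral_mono hbound).trans_lt ?_
    rw [lintegral_add_left measurable_const, lintegral_tsum fun n =>
      (measurable_const.indicator (hmeas n)).aemeasurable]
    simp only [lintegral_indicator_const (hmeas _)]
    refine ENNReal.add_lt_top.2 ⟨by simp, ?_⟩
    refine (ENNReal.tsum_le_tsum hR).trans_lt ?_
    rw [ENNReal.tsum_geometric]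
    simp

section Functional

variable {d : ℕ}

/-- The divergence `∑ⱼ ∂ⱼ vʲ` of a vector field. -/
def divergence (v : E d → E d) (x : E d) : ℝ := ∑ j, (fderiv ℝ v x (e j)) j

theorem divergence_add {v w : E d → E d} (hv : Differentiable ℝ v) (hw : Differentiable ℝ w)
    (x : E d) : divergence (v + w) x = divergence v x + divergence w x := by
  simp [divergence, fderiv_add (hv x) (hw x), Finset.sum_add_distrib]

theorem divergence_smul {v : E d → E d} (hv : Differentiable ℝ v) (c : ℝ) (x : E d) :
    divergence (c • v) x = c * divergence v x := by
  simp [divergence, fderiv_const_smul (hv x), Finset.mul_sum]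

theorem abs_divergence_le (v : E d → E d) (x : E d) : |divergence v x| ≤ d * ‖fderiv ℝ v x‖ := by
  refine (Finset.abs_sum_le_sum_abs _ _).trans ?_
  refine (Finset.sum_le_card_nsmul _ _ ‖fderiv ℝ v x‖ fun j _ => ?_).trans (by simp)
  refine (PiLp.norm_apply_le (fderiv ℝ v x (e j)) j).trans ?_
  simpa using (fderiv ℝ v x).le_opNorm (e j)

theorem continuous_divergence (f : C1b d) : Continuous (divergence f.toFun) :=
  continuous_finsetSum _ fun j _ => (EuclideanSpace.proj (𝕜 := ℝ) j).continuous.comp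
    ((f.2.1.continuous_fderiv one_ne_zero).clm_apply continuous_const)

theorem le_strictSeminorms_inl (γ : C₀(E d, ℝ)) (f : C1b d) (x : E d) :
    |γ x| * ‖f.toFun x‖ ≤ strictSeminorms d (.inl γ) f :=
  le_ciSup (bddAbove_weight γ f.2.2.1) x

theorem le_strictSeminorms_inr (γ : C₀(E d, ℝ)) (f : C1b d) (x : E d) :
    |γ x| * ‖fderiv ℝ f.toFun x‖ ≤ strictSeminorms d (.inr γ) f :=
  le_ciSup (bddAbove_weight γ f.2.2.2) x

variable (Q : Measure (E d)) [IsFiniteMeasure Q] {m : E d → E d}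

theorem integrable_divergence_add_inner (c : ℝ) (hm : Integrable m Q) (f : C1b d) :
    Integrable (fun x => c * divergence f.toFun x + inner ℝ (m x) (f.toFun x)) Q := by
  obtain ⟨A, hA⟩ := f.2.2.1
  obtain ⟨B, hB⟩ := f.2.2.2
  refine Integrable.add (Integrable.const_mul ?_ c) ?_
  · refine (integrable_const (d * B)).mono' (continuous_divergence f).aestronglyMeasurable
      (Eventually.of_forall fun x => (abs_divergence_le _ x).trans ?_)
    exact mul_le_mul_of_nonneg_left (hB x) (Nat.cast_nonneg d)
  · refine (hm.norm.mul_const A).mono'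
      (hm.1.inner f.differentiable.continuous.aestronglyMeasurable)
      (Eventually.of_forall fun x => (norm_inner_le_norm _ _).trans ?_)
    exact mul_le_mul_of_nonneg_left (hA x) (norm_nonneg _)

/-- The linear functional `v ↦ ∫ (c div v + ⟨m, v⟩) dQ` on `C¹_b`. -/
def divInnerLinear (c : ℝ) (hm : Integrable m Q) : C1b d →ₗ[ℝ] ℝ where
  toFun f := ∫ x, (c * divergence f.toFun x + inner ℝ (m x) (f.toFun x)) ∂Q
  map_add' f g := by
    rw [← integral_add (integrable_divergence_add_inner Q c hm f)
      (integrable_divergence_add_inner Q c hm g)]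
    congr 1
    funext x
    rw [C1b.toFun_add, divergence_add f.differentiable g.differentiable, Pi.add_apply,
      inner_add_right]
    ring
  map_smul' a f := by
    rw [RingHom.id_apply, smul_eq_mul, ← integral_const_mul]
    congr 1
    funext x
    rw [C1b.toFun_smul, divergence_smul f.differentiable, Pi.smul_apply, inner_smul_right]
    ring

/-- Continuity for the strict topology: the weight is chosen so that its inverse is integrable
against `(1 + ‖m‖) Q`. -/
theorem continuous_divInnerLinear (c : ℝ) (hm : Integrable m Q) :
    Continuous (divInnerLinear Q c hm) := by
  classical
  refine (withSeminorms_strictSeminorms d).continuous_real_rng (divInnerLinear Q c hm) ?_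
  have hw : Integrable (fun x => 1 + ‖m x‖) Q := (integrable_const 1).add hm.norm
  have : IsFiniteMeasure (Q.withDensity fun x => ENNReal.ofReal (1 + ‖m x‖)) :=
    isFiniteMeasure_withDensity_ofReal hw.2
  obtain ⟨γ, hγ0, hγ⟩ := exists_zeroAtInfty_lintegral_inv_lt_top
    (Q.withDensity fun x => ENNReal.ofReal (1 + ‖m x‖))
  have hγc : Continuous fun x => (γ x)⁻¹ := γ.continuous.inv₀ fun x => (hγ0 x).ne'
  have hI : Integrable (fun x => (1 + ‖m x‖) * (γ x)⁻¹) Q := by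
    refine ⟨hw.1.mul hγc.aestronglyMeasurable, ?_⟩
    rw [lintegral_withDensity_eq_lintegral_mul₀' hw.1.aemeasurable.ennreal_ofReal
      (by fun_prop)] at hγ
    rw [hasFiniteIntegral_iff_ofReal (Eventually.of_forall fun x =>
      mul_nonneg (by positivity) (inv_nonneg.2 (hγ0 x).le))]
    convert hγ using 3 with x
    rw [Pi.mul_apply, ENNReal.ofReal_mul (by positivity)]
  set W := ∫ x, (1 + ‖m x‖) * (γ x)⁻¹ ∂Q
  refine ⟨{.inl γ, .inr γ}, Real.toNNReal (W * (|c| * d + 1)), fun f => ?_⟩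
  set S := (({.inl γ, .inr γ} : Finset (C₀(E d, ℝ) ⊕ C₀(E d, ℝ))).sup (strictSeminorms d)) f
  -- both `‖f‖` and `‖∂f‖` are at most `S / γ`, and `(1 + ‖m‖) / γ` is integrable
  have hW : 0 ≤ W := integral_nonneg fun x =>
    mul_nonneg (by positivity) (inv_nonneg.2 (hγ0 x).le)
  have hS : ∀ i ∈ ({.inl γ, .inr γ} : Finset (C₀(E d, ℝ) ⊕ C₀(E d, ℝ))),
      strictSeminorms d i f ≤ S := fun i hi => Seminorm.le_finset_sup_apply hi
  have hb0 : ∀ x, ‖f.toFun x‖ ≤ (γ x)⁻¹ * S := fun x => by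
    have := (le_strictSeminorms_inl γ f x).trans (hS _ (by simp))
    rw [abs_of_pos (hγ0 x)] at this
    rwa [inv_mul_eq_div, le_div_iff₀' (hγ0 x)]
  have hb1 : ∀ x, ‖fderiv ℝ f.toFun x‖ ≤ (γ x)⁻¹ * S := fun x => by
    have := (le_strictSeminorms_inr γ f x).trans (hS _ (by simp))
    rw [abs_of_pos (hγ0 x)] at this
    rwa [inv_mul_eq_div, le_div_iff₀' (hγ0 x)]
  have hS0 : 0 ≤ S := apply_nonneg _ _
  change ∫ x, (c * divergence f.toFun x + inner ℝ (m x) (f.toFun x)) ∂Q ≤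
    ((Real.toNNReal (W * (|c| * d + 1)) : NNReal) : ℝ) * S
  rw [Real.coe_toNNReal _ (by positivity)]
  calc _ ≤ ∫ x, ((1 + ‖m x‖) * (γ x)⁻¹) * ((|c| * d + 1) * S) ∂Q := by
        refine integral_mono (integrable_divergence_add_inner Q c hm f) (hI.mul_const _)
          fun x => ?_
        have hg := inv_pos.2 (hγ0 x)
        calc c * divergence f.toFun x + inner ℝ (m x) (f.toFun x)
            ≤ |c| * (d * ((γ x)⁻¹ * S)) + ‖m x‖ * ((γ x)⁻¹ * S) := by
              refine add_le_add ?_ ?_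
              · refine (le_abs_self _).trans ?_
                rw [abs_mul]
                refine mul_le_mul_of_nonneg_left ((abs_divergence_le _ x).trans ?_) (abs_nonneg _)
                exact mul_le_mul_of_nonneg_left (hb1 x) (Nat.cast_nonneg d)
              · exact (real_inner_le_norm _ _).trans
                  (mul_le_mul_of_nonneg_left (hb0 x) (norm_nonneg _))
          _ ≤ ((1 + ‖m x‖) * (γ x)⁻¹) * ((|c| * d + 1) * S) := by
              have h1 : 0 ≤ ‖m x‖ * (|c| * d) * ((γ x)⁻¹ * S) := by positivity
              have h2 : 0 ≤ (γ x)⁻¹ * S := by positivity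
              nlinarith
    _ = W * (|c| * d + 1) * S := by rw [integral_mul_const]; ring

/-- The distribution `v ↦ ∫ (c div v + ⟨m, v⟩) dQ` in `D¹_{L¹}`. -/
def divInnerFunctional (c : ℝ) (hm : Integrable m Q) : DL1 d where
  toLinearMap := divInnerLinear Q c hm
  cont := continuous_divInnerLinear Q c hm

theorem divInnerFunctional_apply (c : ℝ) (hm : Integrable m Q) (f : C1b d) :
    divInnerFunctional Q c hm f =
      ∫ x, (c * divergence f.toFun x + inner ℝ (m x) (f.toFun x)) ∂Q := rfl

end Functional

/-! ### Kernels with a feature map -/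

section FeatureMap

variable {X H : Type*} [NormedAddCommGroup H] [InnerProductSpace ℝ H]
  {k : X → X → ℝ} {ξ : X → H}

theorem scalarKernel_apply (k : X → X → ℝ) (x y : X) (c : ℝ) :
    scalarKernel k x y c = k x y * c := rfl

/-- A kernel with a feature map is positive semidefinite. -/
theorem posSemidef_scalarKernel_of_feature (hk : ∀ x y, k x y = inner ℝ (ξ x) (ξ y)) :
    (scalarKernel k).PosSemidef := by
  have htfae := (RKHS.posSemidef_tfae (K := scalarKernel k)).out 0 2
  refine htfae.2 ⟨?_, fun vv => ?_⟩
  · ext x y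
    refine ext_inner_right ℝ fun w => ?_
    rw [Matrix.conjTranspose_apply, ContinuousLinearMap.star_eq_adjoint,
      ContinuousLinearMap.adjoint_inner_left, scalarKernel_apply, scalarKernel_apply, hk, hk,
      real_inner_comm]
    simp [mul_comm, real_inner_comm]
  · have : (vv.sum fun x w => vv.sum fun x' w' => inner ℝ (scalarKernel k x' x w) w') =
        inner ℝ (vv.sum fun x w => w • ξ x) (vv.sum fun x w => w • ξ x) := by
      simp only [Finsupp.sum, sum_inner, inner_sum, scalarKernel_apply, hk]
      refine Finset.sum_congr rfl fun x _ => Finset.sum_congr rfl fun y _ => ?_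
      rw [real_inner_smul_left, real_inner_smul_right, real_inner_comm]
      simp; ring
    rw [this]
    simp

variable [CompleteSpace H] [Fact (scalarKernel k).PosSemidef]

theorem inner_kerFun_kerFun_scalarKernel (x y : X) :
    inner ℝ (RKHS.kerFun (RKHS.OfKernel (scalarKernel k)) x 1)
      (RKHS.kerFun (RKHS.OfKernel (scalarKernel k)) y 1) = k x y := by
  rw [RKHS.kerFun_inner, RKHS.kerFun_apply, RKHS.OfKernel.kernel_ofKernel, scalarKernel_apply]
  simp

theorem denseRange_linearCombination_kerFun :
    DenseRange (Finsupp.linearCombination ℝ fun x : X =>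
      RKHS.kerFun (RKHS.OfKernel (scalarKernel k)) x 1) := by
  rw [DenseRange, ← LinearMap.coe_range, Finsupp.range_linearCombination,
    Submodule.dense_iff_topologicalClosure_eq_top, eq_top_iff,
    ← RKHS.kerFun_dense (RKHS.OfKernel (scalarKernel k))]
  refine Submodule.topologicalClosure_mono (Submodule.span_le.2 ?_)
  rintro _ ⟨x, v, rfl⟩
  rw [← mul_one v, ← smul_eq_mul, map_smul]
  exact Submodule.smul_mem _ _ (Submodule.subset_span ⟨x, rfl⟩)

/-- The canonical isometry of the RKHS of a kernel into the target space of a feature map. -/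
theorem exists_linearIsometry_of_feature (hk : ∀ x y, k x y = inner ℝ (ξ x) (ξ y)) :
    ∃ A : RKHS.OfKernel (scalarKernel k) →ₗᵢ[ℝ] H, ∀ x, A (RKHS.kerFun _ x 1) = ξ x := by
  set L := Finsupp.linearCombination ℝ fun x : X =>
      RKHS.kerFun (RKHS.OfKernel (scalarKernel k)) x 1 with hL
  set M := Finsupp.linearCombination ℝ ξ with hM
  have hnorm : ∀ v, ‖M v‖ = ‖L v‖ := fun v => by
    rw [← sq_eq_sq₀ (norm_nonneg _) (norm_nonneg _), ← real_inner_self_eq_norm_sq,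
      ← real_inner_self_eq_norm_sq, hL, hM]
    simp only [Finsupp.linearCombination_apply, Finsupp.sum, sum_inner, inner_sum,
      real_inner_smul_left, real_inner_smul_right, inner_kerFun_kerFun_scalarKernel, hk]
  have hd : DenseRange L := denseRange_linearCombination_kerFun
  have hext : ∀ v, M.extendOfNorm L (L v) = M v :=
    LinearMap.extendOfNorm_eq hd ⟨1, fun v => by rw [hnorm, one_mul]⟩
  refine ⟨⟨(M.extendOfNorm L).toLinearMap, fun f => ?_⟩, fun x => ?_⟩
  · refine hd.induction_on (p := fun f => ‖M.extendOfNorm L f‖ = ‖f‖) f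
      (isClosed_eq (by fun_prop) (by fun_prop)) fun v => ?_
    rw [hext, hnorm]
  · have := hext (Finsupp.single x 1)
    simpa [hL, hM] using this

/-- The functions of the RKHS of a kernel with feature map `ξ` are the `x ↦ ⟨ξ x, g⟩`. -/
theorem exists_forall_apply_eq_inner (hk : ∀ x y, k x y = inner ℝ (ξ x) (ξ y))
    (h : RKHS.OfKernel (scalarKernel k)) : ∃ g : H, ∀ x, h x = inner ℝ (ξ x) g := by
  obtain ⟨A, hA⟩ := exists_linearIsometry_of_feature hk
  refine ⟨A h, fun x => ?_⟩
  rw [← hA, A.inner_map_map, RKHS.kerFun_inner]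
  simp

theorem exists_ofKernel_forall_apply_eq_inner (hk : ∀ x y, k x y = inner ℝ (ξ x) (ξ y)) (g : H) :
    ∃ h : RKHS.OfKernel (scalarKernel k), ∀ x, h x = inner ℝ (ξ x) g := by
  obtain ⟨A, hA⟩ := exists_linearIsometry_of_feature hk
  refine ⟨A.toContinuousLinearMap.adjoint g, fun x => ?_⟩
  have h1 := RKHS.kerFun_inner x (1 : ℝ) (A.toContinuousLinearMap.adjoint g)
  rw [ContinuousLinearMap.adjoint_inner_right, LinearIsometry.coe_toContinuousLinearMap, hA] at h1
  rw [h1]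
  simp

end FeatureMap

/-! ### Maximum mean discrepancy -/

theorem extIntegral_eq_integral {X : Type*} [MeasurableSpace X] {Q : Measure X} {h : X → ℝ}
    (hh : Integrable h Q) : extIntegral Q h = ((∫ x, h x ∂Q : ℝ) : EReal) := by
  have h1 : (∫⁻ x, ENNReal.ofReal (h x) ∂Q) ≠ ∞ := hh.lintegral_lt_top.ne
  have h2 : (∫⁻ x, ENNReal.ofReal (-h x) ∂Q) ≠ ∞ := hh.neg.lintegral_lt_top.ne
  rw [extIntegral, integral_eq_lintegral_pos_part_sub_lintegral_neg_part hh, EReal.coe_sub,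
    EReal.coe_ennreal_toReal h1, EReal.coe_ennreal_toReal h2]

theorem integral_eq_of_mmd_eq_zero {X : Type*} [MeasurableSpace X]
    {k : Matrix X X (ℝ →L[ℝ] ℝ)} [Fact k.PosSemidef] {Q P : Measure X} (h0 : mmd k Q P = 0)
    (h : RKHS.OfKernel k) (hh : Integrable (fun x => h x) Q) :
    ∫ x, h x ∂Q = ∫ x, h x ∂P := by
  set c := (‖h‖ + 1)⁻¹ with hc
  have hc0 : 0 < c := by positivity
  have hi : Integrable (fun x => (c • h) x) Q := by
    simpa using hh.const_mul c
  have h1 : ‖c • h‖ ≤ 1 := by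
    rw [norm_smul, Real.norm_of_nonneg hc0.le, hc, inv_mul_le_one₀ (by positivity)]
    linarith
  have h2 := h0
  simp only [mmd, ENNReal.iSup_eq_zero] at h2
  have h3 := h2 (c • h) h1 hi.pos_part
  rw [EReal.abs_eq_zero_iff, extIntegral_eq_integral hi, ← EReal.coe_sub, EReal.coe_eq_zero,
    sub_eq_zero] at h3
  simp only [RKHS.coe_smul, Pi.smul_apply, smul_eq_mul, integral_const_mul] at h3
  exact mul_left_cancel₀ hc0.ne' h3

/-! ### The Stein operator on the RKHS and the Stein kernel -/

section Stein

variable {d : ℕ} {K : MatrixKernel d} [Fact K.PosSemidef]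
  {hK : ∀ h : RKHS.OfKernel K, (fun x => h x) ∈ c1bSubmodule d}

/-- For a characteristic kernel, a distribution in `D¹_{L¹}` is determined by its values on the
RKHS. -/
theorem IsDL1Characteristic.eq_zero (hchar : IsDL1Characteristic K hK) {D : DL1 d}
    (hD : ∀ h : RKHS.OfKernel K, D (⟨fun x => h x, hK h⟩ : c1bSubmodule d) = 0) : D = 0 :=
  hchar D 0 0 (fun h => by rw [hD h, inner_zero_left])
    (fun h => by rw [inner_zero_left]; rfl)

/-- A bounded `C¹` function with bounded derivative times a basis vector. -/
def C1b.smulSingle {φ : E d → ℝ} (hφ : ContDiff ℝ 1 φ) (hb : ∃ C, ∀ x, ‖φ x‖ ≤ C)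
    (hb' : ∃ C, ∀ x, ‖fderiv ℝ φ x‖ ≤ C) (i : Fin d) : C1b d :=
  ⟨fun x => φ x • e i, hφ.smul contDiff_const, by
    obtain ⟨C, hC⟩ := hb
    exact ⟨C, fun x => by simpa [norm_smul] using hC x⟩, by
    obtain ⟨C, hC⟩ := hb'
    refine ⟨C, fun x => ?_⟩
    rw [fderiv_smul_const (hφ.differentiable one_ne_zero x)]
    simpa using hC x⟩

theorem C1b.toFun_smulSingle {φ : E d → ℝ} (hφ : ContDiff ℝ 1 φ) (hb : ∃ C, ∀ x, ‖φ x‖ ≤ C)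
    (hb' : ∃ C, ∀ x, ‖fderiv ℝ φ x‖ ≤ C) (i : Fin d) (x : E d) :
    (C1b.smulSingle hφ hb hb' i).toFun x = φ x • e i := rfl

theorem divergence_smulSingle {φ : E d → ℝ} (hφ : ContDiff ℝ 1 φ) (hb : ∃ C, ∀ x, ‖φ x‖ ≤ C)
    (hb' : ∃ C, ∀ x, ‖fderiv ℝ φ x‖ ≤ C) (i : Fin d) (x : E d) :
    divergence (C1b.smulSingle hφ hb hb' i).toFun x = fderiv ℝ φ x (e i) := by
  have : fderiv ℝ (C1b.smulSingle hφ hb hb' i).toFun x = (fderiv ℝ φ x).smulRight (e i) :=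
    fderiv_smul_const (hφ.differentiable one_ne_zero x) _
  simp [divergence, this]

/-- For a characteristic kernel, no component of the functions of the RKHS vanishes identically at
a point: otherwise the RKHS would be annihilated by a Dirac distribution. -/
theorem IsDL1Characteristic.exists_apply_ne_zero (hchar : IsDL1Characteristic K hK) (x : E d)
    (i : Fin d) : ∃ h : RKHS.OfKernel K, (h x) i ≠ 0 := by
  by_contra! h0
  have hm : Integrable (fun _ : E d => (e i : E d)) (Measure.dirac x) := integrable_const _
  have hval : ∀ f : C1b d, divInnerFunctional (Measure.dirac x) 0 hm f = (f.toFun x) i := by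
    intro f
    rw [divInnerFunctional_apply, integral_dirac]
    simp [EuclideanSpace.inner_single_left]
  have hD : divInnerFunctional (Measure.dirac x) 0 hm = 0 :=
    hchar.eq_zero fun h => (hval _).trans (h0 h)
  have h1 := hval (C1b.smulSingle (φ := fun _ => 1) contDiff_const ⟨1, by simp⟩ ⟨0, by simp⟩ i)
  rw [hD, C1b.toFun_smulSingle] at h1
  simp at h1

variable {P : Measure (E d)} {p : E d → ℝ}

theorem hasDerivAt_component_line {v : E d → E d} (hv : Differentiable ℝ v) (x : E d)
    (i j : Fin d) :
    HasDerivAt (fun t : ℝ => (v (x + t • e i)) j) ((fderiv ℝ v x (e i)) j) 0 :=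
  (EuclideanSpace.proj (𝕜 := ℝ) j).hasFDerivAt.comp_hasDerivAt 0
    ((hv x).hasFDerivAt.hasLineDerivAt (e i))

theorem differentiable_coe_ofKernel (hK : ∀ h : RKHS.OfKernel K, (fun x => h x) ∈ c1bSubmodule d)
    (h : RKHS.OfKernel K) : Differentiable ℝ fun x => h x :=
  (hK h).1.differentiable one_ne_zero

/-- Locally along each line, `log p` is recovered from `p h` by division by a component of some
`h` in the RKHS which does not vanish there. -/
theorem HasZeroMeanSteinRKHS.partiallyDifferentiable_log (hP : HasZeroMeanSteinRKHS K P p)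
    (hchar : IsDL1Characteristic K hK) : PartiallyDifferentiable fun x => Real.log (p x) := by
  intro x i
  obtain ⟨h, hh⟩ := hchar.exists_apply_ne_zero x i
  have h1 : DifferentiableAt ℝ (fun t : ℝ => p (x + t • e i) • h (x + t • e i)) 0 :=
    hP.partiallyDifferentiable h x i
  have h2 : DifferentiableAt ℝ (fun t : ℝ => p (x + t • e i) * (h (x + t • e i)) i) 0 :=
    (EuclideanSpace.proj (𝕜 := ℝ) i).differentiableAt.comp 0 h1
  have h3 := (hasDerivAt_component_line (differentiable_coe_ofKernel hK h) x i i).differentiableAt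
  have h4 : (h (x + (0 : ℝ) • e i)) i ≠ 0 := by simpa using hh
  have h5 : DifferentiableAt ℝ (fun t : ℝ => p (x + t • e i)) 0 := by
    refine (h2.fun_div h3 h4).congr_of_eventuallyEq ?_
    filter_upwards [h3.continuousAt.eventually_ne h4] with t ht
    rw [mul_div_cancel_right₀ _ ht]
  exact h5.log (hP.pos _).ne'

theorem langevin_eq_divergence_add_inner (hpos : ∀ x, 0 < p x)
    (hlog : PartiallyDifferentiable fun x => Real.log (p x)) {v : E d → E d}
    (hv : Differentiable ℝ v) (x : E d) :
    langevin p v x = divergence v x + inner ℝ (score p x) (v x) := by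
  have h1 : ∀ j, partialDeriv j (fun z => p z * v z j) x =
      p x * ((fderiv ℝ v x (e j)) j + score p x j * v x j) := by
    intro j
    have h2 : HasDerivAt (fun t : ℝ => p (x + t • e j)) (p x * score p x j) 0 := by
      have := (hasDerivAt_log_line hlog x j).exp
      simpa [Real.exp_log (hpos _)] using this
    have h3 := (h2.mul (hasDerivAt_component_line hv x j j)).deriv
    simp only [zero_smul, add_zero] at h3
    refine h3.trans ?_
    ring
  rw [langevin, Finset.sum_congr rfl fun j _ => h1 j, ← Finset.mul_sum, ← mul_assoc,
    one_div_mul_cancel (hpos x).ne', one_mul, Finset.sum_add_distrib, divergence]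
  congr 1
  simp [PiLp.inner_apply, mul_comm]

/-- Partial derivatives of the functions of the RKHS are continuous functionals, as pointwise limits
of difference quotients. -/
theorem exists_clm_eq_fderiv_apply
    (hK : ∀ h : RKHS.OfKernel K, (fun x => h x) ∈ c1bSubmodule d) (x : E d) (j : Fin d) :
    ∃ T : RKHS.OfKernel K →L[ℝ] ℝ, ∀ h, T h = (fderiv ℝ (fun x => h x) x (e j)) j := by
  set ev : E d → RKHS.OfKernel K →L[ℝ] ℝ := fun y =>
    EuclideanSpace.proj j ∘L ContinuousLinearMap.proj y ∘L RKHS.coeCLM ℝ with hev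
  refine ⟨continuousLinearMapOfTendsto (l := atTop)
    (fun n : ℕ => ((n : ℝ) + 1) • (ev (x + ((n : ℝ) + 1)⁻¹ • e j) - ev x))
    (f := fun h => (fderiv ℝ (fun x => h x) x (e j)) j) ?_, fun h => rfl⟩
  rw [tendsto_pi_nhds]
  intro h
  have h1 := (hasDerivAt_component_line (differentiable_coe_ofKernel hK h) x j j).tendsto_slope_zero
  have h2 : Tendsto (fun n : ℕ => ((n : ℝ) + 1)⁻¹) atTop (𝓝[≠] 0) := by
    refine tendsto_nhdsWithin_iff.2 ⟨?_, Eventually.of_forall fun n => ?_⟩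
    · simpa using tendsto_one_div_add_atTop_nhds_zero_nat (𝕜 := ℝ)
    · simp only [mem_compl_iff, mem_singleton_iff]; positivity
  refine (h1.comp h2).congr fun n => ?_
  simp [hev]

/-- The Stein features: `h ↦ S_p h (x)` is represented by an element `ξ x` of the RKHS. -/
theorem exists_steinFeature (hK : ∀ h : RKHS.OfKernel K, (fun x => h x) ∈ c1bSubmodule d)
    (hpos : ∀ x, 0 < p x) (hlog : PartiallyDifferentiable fun x => Real.log (p x)) :
    ∃ ξ : E d → RKHS.OfKernel K, ∀ x h, inner ℝ (ξ x) h = langevin p (fun z => h z) x := by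
  choose T hT using exists_clm_eq_fderiv_apply hK
  refine ⟨fun x => (InnerProductSpace.toDual ℝ _).symm (∑ j, T x j)
    + RKHS.kerFun _ x (score p x), fun x h => ?_⟩
  rw [langevin_eq_divergence_add_inner hpos hlog (differentiable_coe_ofKernel hK h), inner_add_left,
    InnerProductSpace.toDual_symm_apply, RKHS.kerFun_inner, _root_.sum_apply]
  simp only [hT, divergence]

theorem sum_partialDeriv_eq (hpos : ∀ x, 0 < p x) (v : E d → E d) (x : E d) :
    ∑ i, partialDeriv i (fun z => p z * v z i) x = p x * langevin p v x := by
  rw [langevin, ← mul_assoc, mul_one_div_cancel (hpos x).ne', one_mul]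

/-- The Stein kernel is the kernel of the Stein features. -/
theorem steinKernel_eq_scalarKernel_inner (hpos : ∀ x, 0 < p x) {ξ : E d → RKHS.OfKernel K}
    (hξ : ∀ x h, inner ℝ (ξ x) h = langevin p (fun z => h z) x) :
    steinKernel p K = scalarKernel fun x y => inner ℝ (ξ x) (ξ y) := by
  unfold steinKernel
  congr 1
  funext x y
  have hin : ∀ (j : Fin d) (y' : E d),
      ∑ i, partialDeriv i (fun x' => p x' * (K x' y' (e j)) i * p y') x =
        p x * (p y' * (ξ x y') j) := by
    intro j y'
    have h1 : ∀ i, partialDeriv i (fun x' => p x' * (K x' y' (e j)) i * p y') x =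
        partialDeriv i (fun x' => p x' * (RKHS.kerFun (RKHS.OfKernel K) y' (e j) x') i) x *
          p y' := by
      intro i
      simp only [RKHS.kerFun_apply, RKHS.OfKernel.kernel_ofKernel]
      exact deriv_mul_const_field _
    rw [Finset.sum_congr rfl fun i _ => h1 i, ← Finset.sum_mul,
      sum_partialDeriv_eq hpos (fun x' => RKHS.kerFun (RKHS.OfKernel K) y' (e j) x'), ← hξ,
      RKHS.inner_kerFun, EuclideanSpace.inner_single_right]
    simp; ring
  have hout : ∀ j : Fin d, partialDeriv j (fun y' =>
      ∑ i, partialDeriv i (fun x' => p x' * (K x' y' (e j)) i * p y') x) y =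
        p x * partialDeriv j (fun y' => p y' * (ξ x y') j) y := by
    intro j
    simp only [hin]
    exact deriv_const_mul_field _
  rw [Finset.sum_congr rfl fun j _ => hout j, ← Finset.mul_sum,
    sum_partialDeriv_eq hpos (fun y' => ξ x y'), ← hξ, real_inner_comm]
  have h1 := (hpos x).ne'
  have h2 := (hpos y).ne'
  field_simp

/-- If all Stein functions of the RKHS integrate to zero against `Q`, then the score of `p` is the
weak logarithmic gradient of `Q`. -/
theorem IsDL1Characteristic.hasLogDerivAlong_score (hchar : IsDL1Characteristic K hK)
    (hpos : ∀ x, 0 < p x) (hlog : PartiallyDifferentiable fun x => Real.log (p x))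
    {Q : Measure (E d)} [IsFiniteMeasure Q] (hs : Integrable (score p) Q)
    (h0 : ∀ h : RKHS.OfKernel K, ∫ x, langevin p (fun z => h z) x ∂Q = 0) (i : Fin d) :
    HasLogDerivAlong Q (e i) fun x => score p x i := by
  have hD : divInnerFunctional Q 1 hs = 0 := by
    refine hchar.eq_zero fun h => ?_
    rw [← h0 h]
    refine (divInnerFunctional_apply Q 1 hs _).trans (integral_congr_ae (Eventually.of_forall ?_))
    intro x
    simp only [one_mul]
    exact (langevin_eq_divergence_add_inner hpos hlog (differentiable_coe_ofKernel hK h) x).symm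
  intro φ hφ hb hb'
  have h1 := divInnerFunctional_apply Q 1 hs (C1b.smulSingle hφ hb hb' i)
  rw [hD] at h1
  refine Eq.trans ?_ h1.symm
  congr 1
  funext x
  rw [divergence_smulSingle, C1b.toFun_smulSingle, inner_smul_right,
    EuclideanSpace.inner_single_right]
  simp [mul_comm]

end Stein

end KSD

open KSD

theorem mainTheorem5 (d : ℕ) (K : KSD.MatrixKernel d) [Fact K.PosSemidef]
    (hK : ∀ h : RKHS.OfKernel K, (fun x => h x) ∈ KSD.c1bSubmodule d)
    (hchar : KSD.IsDL1Characteristic K hK)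
    (P : MeasureTheory.Measure (KSD.E d)) (p : KSD.E d → ℝ)
    (hP : KSD.HasZeroMeanSteinRKHS K P p) :
    KSD.PartiallyDifferentiable (fun x => Real.log (p x)) ∧
    ∃ _ : Fact (KSD.steinKernel p K).PosSemidef,
      P ∈ KSD.embeddable (KSD.steinKernel p K) ∧
      KSD.Separates (KSD.steinKernel p K) P (KSD.scoreIntegrating p) := by
  have hlog := hP.partiallyDifferentiable_log hchar
  obtain ⟨ξ, hξ⟩ := exists_steinFeature hK hP.pos hlog
  rw [steinKernel_eq_scalarKernel_inner hP.pos hξ]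
  have hk : ∀ x y, (fun x y => inner ℝ (ξ x) (ξ y) : E d → E d → ℝ) x y = inner ℝ (ξ x) (ξ y) :=
    fun _ _ => rfl
  have hfact : Fact (scalarKernel fun x y => inner ℝ (ξ x) (ξ y)).PosSemidef :=
    ⟨posSemidef_scalarKernel_of_feature hk⟩
  refine ⟨hlog, hfact, ⟨hP.isProbabilityMeasure, fun h => ?_⟩, fun Q hQ hmmd => ?_⟩
  · obtain ⟨g, hg⟩ := exists_forall_apply_eq_inner hk h
    simpa only [hg, hξ] using hP.integrable g
  · have hQprob : IsProbabilityMeasure Q := hQ.1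
    have hPprob := hP.isProbabilityMeasure
    have hs : Integrable (score p) Q :=
      (integrable_norm_iff (measurable_score hP.measurable hlog).aestronglyMeasurable).1 hQ.2
    refine eq_of_hasLogDerivAlong hP.measurable hP.pos hlog hP.density hs
      (hchar.hasLogDerivAlong_score hP.pos hlog hs fun g => ?_)
    obtain ⟨h, hh⟩ := exists_ofKernel_forall_apply_eq_inner hk g
    have hi : Integrable (fun x => h x) Q := by
      have h1 := integrable_divergence_add_inner Q 1 hs (⟨fun x => g x, hK g⟩ : c1bSubmodule d)
      refine h1.congr (Eventually.of_forall fun x => ?_)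
      simp only [one_mul, hh, hξ]
      exact (langevin_eq_divergence_add_inner hP.pos hlog (differentiable_coe_ofKernel hK g) x).symm
    have h2 := integral_eq_of_mmd_eq_zero hmmd h hi
    simp only [hh, hξ] at h2
    rw [h2, hP.zero_mean g]

end
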